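/- Let $n\ge 1$ and $1<p<\infty$. For locally integrable $f:\mathbb{R}^n\to\mathbb{R}$ let $$Mf(x)=\sup_{R>0}\frac{1}{m(B_R)}\int_{B_R(x)}|f(y)|\,dy$$ be the Hardy--Littlewood maximal function, where $B_R(x)$ is the ball of radius $R$ centered at $x$, $B_R=B_R(0)$, and $m$ is Lebesgue measure. Let $W^{1,p}(\mathbb{R}^n)$ be the Banach space of all real functions $u\in L^p(\mathbb{R}^n)$ with weak partial derivatives $\partial_1u,\dots,\partial_nu\in L^p(\mathbb{R}^n)$, with the norm $\|u\|_{1,p}=\bigl(\|u\|_p^p+\sum_{i=1}^n\|\partial_iu\|_p^p\bigr)^{1/p}$. Then $M$ maps $W^{1,p}(\mathbb{R}^n)$ into $W^{1,p}(\mathbb{R}^n)$ (in particular, $Mu<\infty$ almost everywhere for every $u\in W^{1,p}(\mathbb{R}^n)$), and $M:W^{1,p}(\mathbb{R}^n)\to W^{1,p}(\mathbb{R}^n)$ is sequentially weakly continuous: if $u_k\rightharpoonup u$ weakly in $W^{1,p}(\mathbb{R}^n)$, then $Mu_k\rightharpoonup Mu$ weakly in $W^{1,p}(\mathbb{R}^n)$.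 -/

import Mathlib

open MeasureTheory Filter Topology
open scoped ENNReal ContDiff

/-- The Hardy-Littlewood maximal function of `f : ℝⁿ → ℝ`,
`Mf(x) = sup_{R > 0} (1 / m(B_R)) ∫_{B_R(x)} |f(y)| dy`, with values in `[0, ∞]`. -/
noncomputable def maximalFunction {n : ℕ} (f : EuclideanSpace ℝ (Fin n) → ℝ)
    (x : EuclideanSpace ℝ (Fin n)) : ℝ≥0∞ :=
  ⨆ (R : ℝ) (_ : 0 < R),
    (volume (Metric.ball x R))⁻¹ * ∫⁻ y in Metric.ball x R, ENNReal.ofReal |f y|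

/-- The locally integrable function `g` is the weak partial derivative `∂u/∂xᵢ` on `ℝⁿ` of the
locally integrable function `u`: for every test function `φ ∈ C_c^∞(ℝⁿ)`,
`∫ u ∂ᵢφ = - ∫ g φ`. -/
def HasWeakPartialDeriv {n : ℕ} (i : Fin n) (u g : EuclideanSpace ℝ (Fin n) → ℝ) : Prop :=
  LocallyIntegrable u volume ∧ LocallyIntegrable g volume ∧
    ∀ φ : EuclideanSpace ℝ (Fin n) → ℝ, ContDiff ℝ ∞ φ → HasCompactSupport φ →
      ∫ x, u x * fderiv ℝ φ x (EuclideanSpace.single i 1) = - ∫ x, g x * φ x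

section weakDerivative

variable {n : ℕ} {i : Fin n} {u v g h : EuclideanSpace ℝ (Fin n) → ℝ}

theorem HasWeakPartialDeriv.congr (H : HasWeakPartialDeriv i u g) (hu : u =ᵐ[volume] v)
    (hg : g =ᵐ[volume] h) : HasWeakPartialDeriv i v h := by
  obtain ⟨h1, h2, h3⟩ := H
  refine ⟨fun x => (h1 x).congr hu, fun x => (h2 x).congr hg, fun φ hφ hc => ?_⟩
  have e1 : ∫ x, v x * fderiv ℝ φ x (EuclideanSpace.single i 1)
      = ∫ x, u x * fderiv ℝ φ x (EuclideanSpace.single i 1) := by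
    refine integral_congr_ae ?_
    filter_upwards [hu] with x hx
    rw [hx]
  have e2 : ∫ x, h x * φ x = ∫ x, g x * φ x := by
    refine integral_congr_ae ?_
    filter_upwards [hg] with x hx
    rw [hx]
  rw [e1, e2, h3 φ hφ hc]

theorem integrable_mul_test {φ : EuclideanSpace ℝ (Fin n) → ℝ} (hu : LocallyIntegrable u volume)
    (hφ : Continuous φ) (hc : HasCompactSupport φ) : Integrable (fun x => u x * φ x) volume := by
  simpa [smul_eq_mul, mul_comm] using hu.integrable_smul_left_of_hasCompactSupport hφ hc

theorem integrable_mul_fderiv_test {φ : EuclideanSpace ℝ (Fin n) → ℝ}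
    (hu : LocallyIntegrable u volume) (hφ : ContDiff ℝ ∞ φ) (hc : HasCompactSupport φ)
    (w : EuclideanSpace ℝ (Fin n)) : Integrable (fun x => u x * fderiv ℝ φ x w) volume :=
  integrable_mul_test hu ((hφ.continuous_fderiv (by simp)).clm_apply continuous_const)
    (hc.fderiv_apply (𝕜 := ℝ) w)

theorem HasWeakPartialDeriv.add (H : HasWeakPartialDeriv i u g) (K : HasWeakPartialDeriv i v h) :
    HasWeakPartialDeriv i (u + v) (g + h) := by
  refine ⟨H.1.add K.1, H.2.1.add K.2.1, fun φ hφ hc => ?_⟩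
  simp only [Pi.add_apply, add_mul]
  rw [integral_add (integrable_mul_fderiv_test H.1 hφ hc _)
      (integrable_mul_fderiv_test K.1 hφ hc _),
    integral_add (integrable_mul_test H.2.1 hφ.continuous hc)
      (integrable_mul_test K.2.1 hφ.continuous hc), H.2.2 φ hφ hc, K.2.2 φ hφ hc]
  ring

theorem HasWeakPartialDeriv.const_smul (H : HasWeakPartialDeriv i u g) (c : ℝ) :
    HasWeakPartialDeriv i (c • u) (c • g) := by
  refine ⟨H.1.smul c, H.2.1.smul c, fun φ hφ hc => ?_⟩
  simp only [Pi.smul_apply, smul_eq_mul, mul_assoc]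
  rw [integral_const_mul, integral_const_mul, H.2.2 φ hφ hc]
  ring

theorem hasWeakPartialDeriv_zero : HasWeakPartialDeriv i (0 : EuclideanSpace ℝ (Fin n) → ℝ) 0 :=
  ⟨locallyIntegrable_zero, locallyIntegrable_zero, fun φ _ _ => by simp⟩

/-- Weak derivatives are unique up to null sets. -/
theorem HasWeakPartialDeriv.ae_unique (H : HasWeakPartialDeriv i u g)
    (K : HasWeakPartialDeriv i u h) : g =ᵐ[volume] h := by
  refine ae_eq_of_integral_contDiff_smul_eq H.2.1 K.2.1 fun φ hφ hc => ?_
  have e : ∫ x, g x * φ x = ∫ x, h x * φ x :=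
    neg_injective ((H.2.2 φ hφ hc).symm.trans (K.2.2 φ hφ hc))
  simpa [smul_eq_mul, mul_comm] using e

end weakDerivative

/-- The Sobolev space `W^{1,p}(ℝⁿ)` of functions `u ∈ L^p(ℝⁿ)` whose weak partial derivatives
`∂₁u, …, ∂ₙu` exist and belong to `L^p(ℝⁿ)`, with the norm
`‖u‖_{1,p} = (‖u‖_p ^ p + ∑ᵢ ‖∂ᵢu‖_p ^ p) ^ (1 / p)`. An element is stored as the tuple
`(u, (∂₁u, …, ∂ₙu))`; it is determined by `u`, see `SobolevW1p.toLp_injective`. -/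
noncomputable def SobolevW1p (n : ℕ) (p : ℝ≥0∞) [Fact (1 ≤ p)] :
    Submodule ℝ (WithLp p (Lp ℝ p (volume : Measure (EuclideanSpace ℝ (Fin n))) ×
      PiLp p (fun _ : Fin n => Lp ℝ p (volume : Measure (EuclideanSpace ℝ (Fin n)))))) where
  carrier := {w | ∀ i : Fin n, HasWeakPartialDeriv i w.fst (w.snd i)}
  add_mem' ha hb i :=
    ((ha i).add (hb i)).congr (Lp.coeFn_add _ _).symm (Lp.coeFn_add _ _).symm
  zero_mem' _ :=
    hasWeakPartialDeriv_zero.congr (Lp.coeFn_zero ℝ p _).symm (Lp.coeFn_zero ℝ p _).symm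
  smul_mem' c _ ha i :=
    ((ha i).const_smul c).congr (Lp.coeFn_smul _ _).symm (Lp.coeFn_smul _ _).symm

namespace SobolevW1p

variable {n : ℕ} {p : ℝ≥0∞} [Fact (1 ≤ p)]

/-- The `L^p` function underlying an element of `W^{1,p}(ℝⁿ)`. -/
def toLp (w : SobolevW1p n p) : Lp ℝ p (volume : Measure (EuclideanSpace ℝ (Fin n))) :=
  (w : WithLp p (Lp ℝ p (volume : Measure (EuclideanSpace ℝ (Fin n))) ×
      PiLp p (fun _ : Fin n => Lp ℝ p (volume : Measure (EuclideanSpace ℝ (Fin n)))))).fst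

theorem toLp_injective : Function.Injective (toLp : SobolevW1p n p → _) := by
  rintro ⟨a, ha⟩ ⟨b, hb⟩ hab
  have hab' : a.fst = b.fst := hab
  apply Subtype.ext
  apply (WithLp.equiv p _).injective
  refine Prod.ext hab' ?_
  apply PiLp.ext
  intro i
  apply Lp.ext
  have h1 := ha i
  rw [hab'] at h1
  exact h1.ae_unique (hb i)

/-- A function `u ∈ L^p(ℝⁿ)` underlies an element of `W^{1,p}(ℝⁿ)` exactly if it has weak partial
derivatives in `L^p(ℝⁿ)`. -/
theorem exists_toLp_eq_iff (u : Lp ℝ p (volume : Measure (EuclideanSpace ℝ (Fin n)))) :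
    (∃ w : SobolevW1p n p, toLp w = u) ↔
      ∀ i : Fin n, ∃ g : EuclideanSpace ℝ (Fin n) → ℝ,
        MemLp g p volume ∧ HasWeakPartialDeriv i u g := by
  constructor
  · rintro ⟨w, rfl⟩ i
    exact ⟨_, Lp.memLp _, w.2 i⟩
  · intro H
    choose g hg hw using H
    refine ⟨⟨WithLp.toLp p (u, WithLp.toLp p fun i => (hg i).toLp (g i)), fun i => ?_⟩, rfl⟩
    exact (hw i).congr (ae_eq_refl _) (hg i).coeFn_toLp.symm

end SobolevW1p

/-- A map `T : E → F` of normed spaces is sequentially weakly continuous if `uₖ ⇀ u` in `E`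
implies `T uₖ ⇀ T u` in `F`, where `⇀` is convergence in the weak topology. -/
def SeqWeaklyContinuous {E F : Type*} [NormedAddCommGroup E] [NormedSpace ℝ E]
    [NormedAddCommGroup F] [NormedSpace ℝ F] (T : E → F) : Prop :=
  ∀ (u : ℕ → E) (u₀ : E),
    Tendsto (fun k => toWeakSpace ℝ E (u k)) atTop (𝓝 (toWeakSpace ℝ E u₀)) →
    Tendsto (fun k => toWeakSpace ℝ F (T (u k))) atTop (𝓝 (toWeakSpace ℝ F (T u₀)))

/-!
# The maximal operator on `W^{1,p}` is sequentially weakly continuous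

Let `1 < p < ∞`. The maximal operator `M` is sublinear, `|Mf - Mg| ≤ M(f - g)`, it commutes with
translations, and it is bounded on `L^p` (`exists_lintegral_hlMaximal_rpow_le`).

*`M` preserves `W^{1,p}`.* A Sobolev function satisfies `‖u(· + y) - u‖ ≤ ∑ᵢ |yᵢ| ‖∂ᵢu‖` in `L^p`
(`eLpNorm_translate_sub_le`), and by sublinearity `Mu` inherits this bound in the direction `eᵢ`,
up to a constant. A weak limit point of the difference quotients of `Mu` is its weak derivative
(`exists_hasWeakPartialDeriv_of_eLpNorm_translate_sub_le`), so that `‖∂ᵢMu‖ ≤ C ‖∂ᵢu‖`.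

*Weak continuity.* Let `uₖ ⇀ u` in `W^{1,p}`. The averages of `uₖ - u` over balls of a fixed radius
tend to `0` pointwise and boundedly, and by the translation estimate they are close to `uₖ - u` in
`L^p`, uniformly in `k`, when the radius is small. Hence `uₖ → u` in `L^p` on bounded sets
(`tendsto_eLpNorm_restrict_of_weak`). Averages over large balls are uniformly small, so on a ball
`M(uₖ - u)` is, up to a small error, the maximal function of the restriction of `uₖ - u` to a larger
ball; thus `Muₖ → Mu` in `L^p` on balls (`tendsto_eLpNorm_maximalFunction_sub`). In particular `Muₖ`
and its derivatives converge as distributions. They are bounded in `L^p`, and test functions are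
dense in the dual of `L^p`, so they converge weakly in `L^p` (`tendsto_dual_of_forall_test`). By the
Hahn-Banach theorem this is weak convergence in `W^{1,p}`.

Both parts use that the dual of `L^p` is `L^q` (`exists_eq_lpPairing`). This is proved here from the
Radon-Nikodym theorem.
-/

/-! ### The Hardy-Littlewood maximal operator -/

section MaximalOperator

open Metric Set
open scoped NNReal

variable {E : Type*} [NormedAddCommGroup E] [MeasurableSpace E]

/-- The centred Hardy-Littlewood maximal function, over open balls, of a function with values in
`[0, ∞]`. -/
noncomputable def hlMaximal (μ : Measure E) (g : E → ℝ≥0∞) (x : E) : ℝ≥0∞ :=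
  ⨆ (R : ℝ) (_ : 0 < R), (μ (ball x R))⁻¹ * ∫⁻ y in ball x R, g y ∂μ

theorem hlMaximal_mono_ae {μ : Measure E} {g h : E → ℝ≥0∞} (hgh : g ≤ᵐ[μ] h) (x : E) :
    hlMaximal μ g x ≤ hlMaximal μ h x := by
  refine iSup₂_mono fun R _ => ?_
  gcongr 1
  exact lintegral_mono_ae (ae_restrict_of_ae hgh)

theorem hlMaximal_congr_ae {μ : Measure E} {g h : E → ℝ≥0∞} (hgh : g =ᵐ[μ] h) :
    hlMaximal μ g = hlMaximal μ h :=
  funext fun x => le_antisymm (hlMaximal_mono_ae hgh.le x) (hlMaximal_mono_ae hgh.symm.le x)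

theorem le_hlMaximal (μ : Measure E) (g : E → ℝ≥0∞) (x : E) {R : ℝ} (hR : 0 < R) :
    (μ (ball x R))⁻¹ * ∫⁻ y in ball x R, g y ∂μ ≤ hlMaximal μ g x :=
  le_iSup₂ (f := fun (R : ℝ) (_ : 0 < R) => (μ (ball x R))⁻¹ * ∫⁻ y in ball x R, g y ∂μ) R hR

theorem hlMaximal_add_le {μ : Measure E} {g h : E → ℝ≥0∞} (hg : AEMeasurable g μ) (x : E) :
    hlMaximal μ (fun y => g y + h y) x ≤ hlMaximal μ g x + hlMaximal μ h x := by
  refine iSup₂_le fun R hR => ?_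
  rw [lintegral_add_left' hg.restrict, mul_add]
  gcongr <;> exact le_hlMaximal _ _ _ hR

theorem hlMaximal_const_le {μ : Measure E} (c : ℝ≥0∞) (x : E) :
    hlMaximal μ (fun _ => c) x ≤ c := by
  refine iSup₂_le fun R hR => ?_
  rw [setLIntegral_const, mul_left_comm]
  exact mul_le_of_le_one_right' (ENNReal.inv_mul_le_one _)

theorem hlMaximal_comp_add_right [BorelSpace E] {μ : Measure E} [μ.IsAddLeftInvariant]
    (g : E → ℝ≥0∞) (h x : E) :
    hlMaximal μ (fun y => g (y + h)) x = hlMaximal μ g (x + h) := by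
  refine iSup_congr fun R => iSup_congr fun _ => ?_
  have hmp : MeasurePreserving (fun y => y + h) μ μ := by
    simpa [add_comm] using measurePreserving_add_left μ h
  have hpre : (fun y => y + h) ⁻¹' ball (x + h) R = ball x R := by
    ext y; simp [dist_eq_norm]
  have hemb : MeasurableEmbedding (fun y : E => y + h) :=
    (Homeomorph.addRight h).measurableEmbedding
  rw [← hpre, hmp.measure_preimage_emb hemb, hmp.setLIntegral_comp_preimage_emb hemb]

variable [BorelSpace E] {μ : Measure E} [μ.IsAddHaarMeasure]

/-- The maximal function is lower semicontinuous: a ball can be shrunk a little, and then its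
centre can be moved a little. -/
theorem isOpen_lt_hlMaximal (g : E → ℝ≥0∞) (t : ℝ≥0∞) : IsOpen {x | t < hlMaximal μ g x} := by
  rw [isOpen_iff_mem_nhds]
  intro x hx
  obtain ⟨R, hx⟩ := lt_iSup_iff.1 (show t < hlMaximal μ g x from hx)
  obtain ⟨hR, hx⟩ := lt_iSup_iff.1 hx
  obtain ⟨u, humono, hulR, hulim⟩ := exists_seq_strictMono_tendsto R
  have hball : ball x R = ⋃ k, ball x (u k) := by
    ext y
    simp only [mem_ball, mem_iUnion]
    constructor
    · intro hy
      exact (hulim.eventually (lt_mem_nhds hy)).exists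
    · rintro ⟨k, hk⟩
      exact hk.trans (hulR k)
  have hlim : Tendsto (fun k => ∫⁻ y in ball x (u k), g y ∂μ) atTop
      (𝓝 (∫⁻ y in ball x R, g y ∂μ)) := by
    simp only [← withDensity_apply _ measurableSet_ball]
    rw [hball]
    exact tendsto_measure_iUnion_atTop fun i j hij => ball_subset_ball (humono.monotone hij)
  have hlim' := ENNReal.Tendsto.const_mul (a := (μ (ball x R))⁻¹) hlim
    (Or.inr (ENNReal.inv_ne_top.2 (measure_ball_pos μ x hR).ne'))
  obtain ⟨k, hk⟩ := (hlim'.eventually (lt_mem_nhds hx)).exists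
  filter_upwards [ball_mem_nhds x (sub_pos.2 (hulR k))] with y hy
  refine (hk.trans_le ?_).trans_le (le_hlMaximal μ g y hR)
  rw [Measure.addHaar_ball_center μ x R, Measure.addHaar_ball_center μ y R]
  gcongr 1
  refine lintegral_mono_set (ball_subset_ball' ?_)
  rw [mem_ball, dist_comm] at hy
  linarith

theorem measurable_hlMaximal (g : E → ℝ≥0∞) : Measurable (hlMaximal μ g) :=
  measurable_of_Ioi fun t => (isOpen_lt_hlMaximal g t).measurableSet

variable [NormedSpace ℝ E] [FiniteDimensional ℝ E]

/-- The weak type `(1, 1)` inequality for the maximal function, from the Vitali covering lemma. -/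
theorem mul_measure_lt_hlMaximal_le [Nontrivial E] (g : E → ℝ≥0∞) (t : ℝ≥0∞) :
    t * μ {x | t < hlMaximal μ g x} ≤ 5 ^ Module.finrank ℝ E * ∫⁻ y, g y ∂μ := by
  rcases eq_or_ne t 0 with rfl | ht0
  · simp
  rcases eq_or_ne t ⊤ with rfl | htop
  · simp
  rcases eq_or_ne (∫⁻ y, g y ∂μ) ⊤ with hI | hI
  · rw [hI, ENNReal.mul_top (by positivity)]
    exact le_top
  set d := Module.finrank ℝ E with hd
  have hd0 : d ≠ 0 := Module.finrank_pos.ne'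
  set S := {x | t < hlMaximal μ g x} with hS
  have hex : ∀ x, ∃ R : ℝ, x ∈ S → 0 < R ∧ t * μ (ball x R) ≤ ∫⁻ y in ball x R, g y ∂μ := by
    intro x
    by_cases hx : x ∈ S
    · obtain ⟨R, hx⟩ := lt_iSup_iff.1 (show t < hlMaximal μ g x from hx)
      obtain ⟨hR, hx⟩ := lt_iSup_iff.1 hx
      refine ⟨R, fun _ => ⟨hR, ?_⟩⟩
      rw [mul_comm, ← div_eq_mul_inv] at hx
      exact ENNReal.mul_le_of_le_div hx.le
    · exact ⟨0, fun h => absurd h hx⟩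
  choose R hR using hex
  have hμ1 : μ (ball (0 : E) 1) ≠ 0 := (measure_ball_pos μ 0 one_pos).ne'
  have hμ1' : μ (ball (0 : E) 1) ≠ ⊤ := measure_ball_lt_top.ne
  -- The radii are bounded, as balls of large measure have small averages.
  have hbdd : ∀ x ∈ S, R x ≤ max 1 ((∫⁻ y, g y ∂μ) / (t * μ (ball (0 : E) 1))).toReal := by
    intro x hx
    obtain ⟨hpos, hle⟩ := hR x hx
    rcases le_total (R x) 1 with h1 | h1
    · exact h1.trans (le_max_left _ _)
    refine le_max_of_le_right ?_
    have h2 : ENNReal.ofReal (R x ^ d) ≤ (∫⁻ y, g y ∂μ) / (t * μ (ball (0 : E) 1)) := by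
      rw [ENNReal.le_div_iff_mul_le (Or.inl (mul_ne_zero ht0 hμ1))
        (Or.inl (ENNReal.mul_ne_top htop hμ1')), mul_left_comm,
        ← Measure.addHaar_ball_of_pos μ x hpos]
      exact hle.trans (setLIntegral_le_lintegral _ _)
    exact (le_self_pow₀ h1 hd0).trans ((ENNReal.ofReal_le_iff_le_toReal
      (ENNReal.div_ne_top hI (mul_ne_zero ht0 hμ1))).1 h2)
  obtain ⟨u, huS, hudisj, hucov⟩ := Vitali.exists_disjoint_subfamily_covering_enlargement_ball
    S id R _ hbdd 5 (by norm_num)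
  have hucount : u.Countable := hudisj.countable_of_isOpen (fun _ _ => isOpen_ball)
    fun x hx => nonempty_ball.2 (hR x (huS hx)).1
  have hsub : S ⊆ ⋃ b ∈ u, ball b (5 * R b) := by
    intro x hx
    obtain ⟨b, hb, hxb⟩ := hucov x hx
    exact mem_biUnion hb (hxb (mem_ball_self (hR x hx).1))
  have hball : ∀ b ∈ u, t * μ (ball b (5 * R b)) ≤ 5 ^ d * ∫⁻ y in ball b (R b), g y ∂μ := by
    intro b hb
    obtain ⟨hpos, hle⟩ := hR b (huS hb)
    rw [Measure.addHaar_ball_mul_of_pos μ b (by norm_num : (0 : ℝ) < 5), ← hd, mul_left_comm,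
      Measure.addHaar_ball_center, ← Measure.addHaar_ball_center μ b,
      ENNReal.ofReal_pow (by norm_num)]
    norm_num
    gcongr
  calc t * μ S ≤ t * ∑' b : u, μ (ball (b : E) (5 * R b)) := by
        gcongr
        exact (measure_mono hsub).trans (measure_biUnion_le μ hucount _)
    _ = ∑' b : u, t * μ (ball (b : E) (5 * R b)) := ENNReal.tsum_mul_left.symm
    _ ≤ ∑' b : u, 5 ^ d * ∫⁻ y in ball (b : E) (R b), g y ∂μ :=
        ENNReal.tsum_le_tsum fun b => hball b b.2
    _ = 5 ^ d * ∫⁻ y in ⋃ b ∈ u, ball b (R b), g y ∂μ := by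
        rw [ENNReal.tsum_mul_left, lintegral_biUnion hucount (fun _ _ => measurableSet_ball)
          (show u.PairwiseDisjoint fun a => ball a (R a) from hudisj)]
    _ ≤ 5 ^ d * ∫⁻ y, g y ∂μ := by
        gcongr
        exact Measure.restrict_le_self

/-- The weak type estimate that sees only the part of `g` above half the height. -/
theorem measure_lt_hlMaximal_le [Nontrivial E] {g : E → ℝ≥0} (hg : Measurable g) {t : ℝ}
    (ht : 0 < t) :
    μ {x | ENNReal.ofReal t < hlMaximal μ (fun y => (g y : ℝ≥0∞)) x} ≤
      2 * 5 ^ Module.finrank ℝ E * ENNReal.ofReal t⁻¹ *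
        (μ.withDensity fun y => (g y : ℝ≥0∞)) {x | t < 2 * (g x : ℝ)} := by
  have hmeas : MeasurableSet {x | t < 2 * (g x : ℝ)} :=
    measurableSet_lt measurable_const (hg.coe_nnreal_real.const_mul 2)
  set A := {x | t < 2 * (g x : ℝ)} with hA
  set G : E → ℝ≥0∞ := fun y => (g y : ℝ≥0∞) with hG
  have hGm : Measurable G := hg.coe_nnreal_ennreal
  have hsplit : ∀ y, G y ≤ A.indicator G y + ENNReal.ofReal (t / 2) := by
    intro y
    by_cases hy : y ∈ A
    · rw [indicator_of_mem hy]
      exact le_self_add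
    · rw [indicator_of_notMem hy, zero_add, hG]
      simp only [hA, mem_ofPred_eq, not_lt] at hy
      rw [ENNReal.le_ofReal_iff_toReal_le ENNReal.coe_ne_top (by positivity)]
      simp only [ENNReal.coe_toReal]
      linarith
  have hsub : {x | ENNReal.ofReal t < hlMaximal μ G x} ⊆
      {x | ENNReal.ofReal (t / 2) < hlMaximal μ (A.indicator G) x} := by
    intro x hx
    by_contra hcon
    simp only [mem_ofPred_eq, not_lt] at hcon hx
    refine hx.not_ge ?_
    calc hlMaximal μ G x
        ≤ hlMaximal μ (fun y => A.indicator G y + ENNReal.ofReal (t / 2)) x :=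
          hlMaximal_mono_ae (Eventually.of_forall hsplit) x
      _ ≤ hlMaximal μ (A.indicator G) x + hlMaximal μ (fun _ => ENNReal.ofReal (t / 2)) x :=
          hlMaximal_add_le (hGm.indicator hmeas).aemeasurable x
      _ ≤ ENNReal.ofReal (t / 2) + ENNReal.ofReal (t / 2) :=
          add_le_add hcon (hlMaximal_const_le _ x)
      _ = ENNReal.ofReal t := by
          rw [← ENNReal.ofReal_add (by positivity) (by positivity), add_halves]
  have hweak := mul_measure_lt_hlMaximal_le (μ := μ) (A.indicator G) (ENNReal.ofReal (t / 2))
  rw [lintegral_indicator hmeas, ← withDensity_apply _ hmeas] at hweak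
  have ht2 : ENNReal.ofReal (t / 2) ≠ 0 := by simpa using ht
  calc μ {x | ENNReal.ofReal t < hlMaximal μ G x}
      ≤ μ {x | ENNReal.ofReal (t / 2) < hlMaximal μ (A.indicator G) x} := measure_mono hsub
    _ ≤ (5 ^ Module.finrank ℝ E * μ.withDensity G A) / ENNReal.ofReal (t / 2) := by
        rw [ENNReal.le_div_iff_mul_le (Or.inl ht2) (Or.inl ENNReal.ofReal_ne_top), mul_comm]
        exact hweak
    _ = 2 * 5 ^ Module.finrank ℝ E * ENNReal.ofReal t⁻¹ * μ.withDensity G A := by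
        rw [div_eq_mul_inv, ← ENNReal.ofReal_inv_of_pos (by positivity), inv_div, div_eq_mul_inv,
          ENNReal.ofReal_mul (by norm_num), ENNReal.ofReal_ofNat]
        ring

/-- The Hardy-Littlewood maximal inequality: the maximal operator is bounded on `L^r`, `r > 1`. -/
theorem exists_lintegral_hlMaximal_rpow_le [Nontrivial E] (μ : Measure E) [μ.IsAddHaarMeasure]
    {r : ℝ} (hr : 1 < r) :
    ∃ C : ℝ≥0, ∀ g : E → ℝ≥0, Measurable g →
      ∫⁻ x, hlMaximal μ (fun y => (g y : ℝ≥0∞)) x ^ r ∂μ ≤ C * ∫⁻ x, (g x : ℝ≥0∞) ^ r ∂μ := by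
  have hr0 : 0 < r := by linarith
  have hr1 : 0 < r - 1 := by linarith
  set K : ℝ≥0 := 2 * 5 ^ Module.finrank ℝ E with hK
  have hKe : (2 * 5 ^ Module.finrank ℝ E : ℝ≥0∞) = K := by simp [hK]
  refine ⟨r.toNNReal * K * (r - 1).toNNReal⁻¹ * 2 ^ (r - 1), fun g hg => ?_⟩
  set G : E → ℝ≥0∞ := fun y => (g y : ℝ≥0∞) with hG
  have hGm : Measurable G := hg.coe_nnreal_ennreal
  have hMm : Measurable (hlMaximal μ G) := measurable_hlMaximal G
  -- The layer cake formula for the measure with density `g`.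
  have hlayer : ∫⁻ t in Ioi (0 : ℝ), (μ.withDensity G) {x | t < 2 * (g x : ℝ)} *
      ENNReal.ofReal (t ^ (r - 1 - 1)) =
      (ENNReal.ofReal (r - 1))⁻¹ * (2 ^ (r - 1) * ∫⁻ x, G x ^ r ∂μ) := by
    have h := lintegral_rpow_eq_lintegral_meas_lt_mul (μ.withDensity G)
      (f := fun x => 2 * (g x : ℝ)) (Eventually.of_forall fun x => by positivity)
      (hg.coe_nnreal_real.const_mul 2).aemeasurable hr1
    have hne : ENNReal.ofReal (r - 1) ≠ 0 := by simpa using hr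
    rw [← ENNReal.inv_mul_cancel_left (a := ENNReal.ofReal (r - 1))
      (b := ∫⁻ t in Ioi (0 : ℝ), _) hne ENNReal.ofReal_ne_top, ← h]
    rw [lintegral_withDensity_eq_lintegral_mul μ hGm
      (by exact (((hg.coe_nnreal_real.const_mul 2).pow_const _).ennreal_ofReal)),
      ← lintegral_const_mul _ (hGm.pow_const r)]
    congr 1
    refine lintegral_congr fun x => ?_
    simp only [Pi.mul_apply]
    rw [← ENNReal.ofReal_rpow_of_nonneg (by positivity) hr1.le,
      ENNReal.ofReal_mul (by norm_num), ENNReal.ofReal_ofNat, ENNReal.ofReal_coe_nnreal,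
      ENNReal.mul_rpow_of_nonneg _ _ hr1.le, mul_left_comm]
    congr 1
    calc G x * G x ^ (r - 1) = G x ^ (1 : ℝ) * G x ^ (r - 1) := by rw [ENNReal.rpow_one]
      _ = G x ^ r := by
        rw [← ENNReal.rpow_add_of_nonneg _ _ zero_le_one hr1.le, add_sub_cancel]
  -- The estimate for the truncations of the maximal function, which have finite values.
  have htrunc : ∀ N : ℕ, ∫⁻ x, min (hlMaximal μ G x) N ^ r ∂μ ≤
      ENNReal.ofReal r * (K * ((ENNReal.ofReal (r - 1))⁻¹ * (2 ^ (r - 1) * ∫⁻ x, G x ^ r ∂μ))) := by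
    intro N
    have hfin : ∀ x, min (hlMaximal μ G x) N ≠ ⊤ := fun x =>
      (min_lt_of_right_lt (ENNReal.natCast_lt_top N)).ne
    have h1 : ∀ x, min (hlMaximal μ G x) N ^ r =
        ENNReal.ofReal ((min (hlMaximal μ G x) N).toReal ^ r) := by
      intro x
      rw [← ENNReal.ofReal_rpow_of_nonneg ENNReal.toReal_nonneg hr0.le,
        ENNReal.ofReal_toReal (hfin x)]
    simp only [h1]
    rw [lintegral_rpow_eq_lintegral_meas_lt_mul μ
      (Eventually.of_forall fun x => ENNReal.toReal_nonneg)
      (hMm.min measurable_const).ennreal_toReal.aemeasurable hr0, ← hlayer,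
      ← lintegral_const_mul' _ _ ENNReal.coe_ne_top]
    gcongr 1
    refine setLIntegral_mono' measurableSet_Ioi fun t ht => ?_
    have ht : 0 < t := ht
    have hsub : {x | t < (min (hlMaximal μ G x) N).toReal} ⊆
        {x | ENNReal.ofReal t < hlMaximal μ G x} := by
      intro x hx
      simp only [mem_ofPred_eq] at hx ⊢
      exact ((ENNReal.ofReal_lt_iff_lt_toReal ht.le (hfin x)).2 hx).trans_le (min_le_left _ _)
    calc μ {x | t < (min (hlMaximal μ G x) N).toReal} * ENNReal.ofReal (t ^ (r - 1))
        ≤ (K * ENNReal.ofReal t⁻¹ * μ.withDensity G {x | t < 2 * (g x : ℝ)}) *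
            ENNReal.ofReal (t ^ (r - 1)) := by
          gcongr
          rw [← hKe]
          exact (measure_mono hsub).trans (measure_lt_hlMaximal_le hg ht)
      _ = K * (μ.withDensity G {x | t < 2 * (g x : ℝ)} *
            (ENNReal.ofReal t⁻¹ * ENNReal.ofReal (t ^ (r - 1)))) := by ring
      _ = _ := by
          rw [← ENNReal.ofReal_mul (by positivity), Real.rpow_sub_one ht.ne' (r - 1),
            div_eq_inv_mul]
  have hsup : ∀ x, hlMaximal μ G x ^ r = ⨆ N : ℕ, min (hlMaximal μ G x) N ^ r := by
    intro x
    have h2 : hlMaximal μ G x = ⨆ N : ℕ, min (hlMaximal μ G x) N := by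
      rw [← inf_iSup_eq, ENNReal.iSup_natCast, inf_top_eq]
    conv_lhs => rw [h2]
    exact (ENNReal.orderIsoRpow r hr0).map_iSup _
  simp only [hsup]
  rw [lintegral_iSup (fun N => (hMm.min measurable_const).pow_const r)]
  · refine iSup_le fun N => (htrunc N).trans (le_of_eq ?_)
    rw [← ENNReal.ofReal_inv_of_pos hr1]
    simp only [ENNReal.ofReal, ENNReal.coe_mul]
    rw [ENNReal.coe_rpow_of_nonneg _ hr1.le, ← Real.toNNReal_inv, ENNReal.coe_ofNat]
    ring
  · intro N N' h x
    simp only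
    gcongr

end MaximalOperator

/-! ### The dual of `L^p` -/

section LpDual

variable {α : Type*} {m : MeasurableSpace α} {μ : Measure α}

/-- Dominated convergence in `L^p`. -/
theorem tendsto_eLpNorm_zero_of_dominated {p : ℝ≥0∞} (hp0 : p ≠ 0) (hp : p ≠ ⊤) {ι : Type*}
    {l : Filter ι} [l.IsCountablyGenerated] {F : ι → α → ℝ} {G : α → ℝ}
    (hF : ∀ i, AEStronglyMeasurable (F i) μ) (hG : MemLp G p μ)
    (hle : ∀ i, ∀ᵐ x ∂μ, ‖F i x‖ ≤ ‖G x‖) (hlim : ∀ᵐ x ∂μ, Tendsto (fun i => F i x) l (𝓝 0)) :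
    Tendsto (fun i => eLpNorm (F i) p μ) l (𝓝 0) := by
  have hr : 0 < p.toReal := ENNReal.toReal_pos hp0 hp
  simp only [eLpNorm_eq_lintegral_rpow_enorm_toReal hp0 hp]
  have h : Tendsto (fun i => ∫⁻ x, ‖F i x‖ₑ ^ p.toReal ∂μ) l (𝓝 (∫⁻ _, 0 ∂μ)) := by
    refine tendsto_lintegral_filter_of_dominated_convergence' (fun x => ‖G x‖ₑ ^ p.toReal)
      (Eventually.of_forall fun i => (hF i).enorm.pow_const _)
      (Eventually.of_forall fun i => ?_)
      (lintegral_rpow_enorm_lt_top_of_eLpNorm_lt_top hp0 hp hG.2).ne ?_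
    · filter_upwards [hle i] with x hx
      gcongr
      exact enorm_le_iff_norm_le.2 hx
    · filter_upwards [hlim] with x hx
      have := (ENNReal.continuous_rpow_const (y := p.toReal)).tendsto _ |>.comp hx.enorm
      simpa [ENNReal.zero_rpow_of_pos hr] using! this
  have h' := (ENNReal.continuous_rpow_const (y := 1 / p.toReal)).tendsto _ |>.comp h
  simpa [ENNReal.zero_rpow_of_pos (inv_pos.2 hr)] using! h'

theorem hasSum_toLp_indicator {p : ℝ≥0∞} [Fact (1 ≤ p)] (hp : p ≠ ⊤) {w : α → ℝ}
    (hw : MemLp w p μ) {f : ℕ → Set α} (hf : ∀ i, MeasurableSet (f i))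
    (hd : Pairwise (Function.onFun Disjoint f)) :
    HasSum (fun i => (hw.indicator (hf i)).toLp ((f i).indicator w))
      ((hw.indicator (MeasurableSet.iUnion hf)).toLp ((⋃ i, f i).indicator w)) := by
  have hU : ∀ S : Finset ℕ, MeasurableSet (⋃ i ∈ S, f i) := fun S =>
    S.measurableSet_biUnion fun i _ => hf i
  have hsum : ∀ S : Finset ℕ, ∑ i ∈ S, (hw.indicator (hf i)).toLp ((f i).indicator w) =
      (hw.indicator (hU S)).toLp ((⋃ i ∈ S, f i).indicator w) := by
    intro S
    induction S using Finset.induction_on with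
    | empty =>
      refine (Lp.ext ?_)
      refine (Lp.coeFn_zero ℝ p μ).trans ((MemLp.coeFn_toLp _).trans ?_).symm
      simp only [Finset.notMem_empty, Set.iUnion_of_empty, Set.iUnion_empty, Set.indicator_empty]
      exact ae_eq_refl _
    | insert a S ha ih =>
      rw [Finset.sum_insert ha, ih, ← MemLp.toLp_add]
      refine (MemLp.toLp_eq_toLp_iff _ _).2 (Eventually.of_forall fun x => ?_)
      have hdisj : Disjoint (f a) (⋃ i ∈ S, f i) := by
        refine Set.disjoint_iUnion₂_right.2 fun i hi => hd ?_
        rintro rfl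
        exact ha hi
      rw [Finset.set_biUnion_insert, Set.indicator_union_of_disjoint hdisj]
      rfl
  unfold HasSum
  simp only [hsum]
  rw [Lp.tendsto_Lp_iff_tendsto_eLpNorm'']
  refine tendsto_eLpNorm_zero_of_dominated (zero_lt_one.trans_le Fact.out).ne' hp (G := w)
    (fun S => ((hw.indicator (hU S)).sub (hw.indicator (MeasurableSet.iUnion hf))).1) hw
    (fun S => Eventually.of_forall fun x => ?_) (Eventually.of_forall fun x => ?_)
  · have hsub : (⋃ i ∈ S, f i) ⊆ ⋃ i, f i := Set.iUnion₂_subset_iUnion _ _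
    by_cases h1 : x ∈ ⋃ i ∈ S, f i
    · simp [Set.indicator_of_mem h1, Set.indicator_of_mem (hsub h1)]
    · by_cases h2 : x ∈ ⋃ i, f i
      · simp [Set.indicator_of_notMem h1, Set.indicator_of_mem h2]
      · simp [Set.indicator_of_notMem h1, Set.indicator_of_notMem h2]
  · refine tendsto_const_nhds.congr' ?_
    by_cases h2 : x ∈ ⋃ i, f i
    · obtain ⟨i, hi⟩ := Set.mem_iUnion.1 h2
      filter_upwards [eventually_ge_atTop ({i} : Finset ℕ)] with S hS
      have h1 : x ∈ ⋃ i ∈ S, f i := Set.mem_biUnion (hS (Finset.mem_singleton_self i)) hi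
      simp [Set.indicator_of_mem h1, Set.indicator_of_mem h2]
    · refine Eventually.of_forall fun S => ?_
      have h1 : x ∉ ⋃ i ∈ S, f i := fun h => h2 (Set.iUnion₂_subset_iUnion _ _ h)
      simp [Set.indicator_of_notMem h1, Set.indicator_of_notMem h2]

/-- On a `σ`-finite measure space there is a positive function in `L^p`. -/
theorem exists_pos_memLp [SigmaFinite μ] {p : ℝ≥0∞} (hp0 : p ≠ 0) (hp : p ≠ ⊤) :
    ∃ w : α → ℝ, (∀ x, 0 < w x) ∧ Measurable w ∧ MemLp w p μ := by
  obtain ⟨g, hg0, hgm, hg⟩ := exists_pos_lintegral_lt_of_sigmaFinite μ one_ne_zero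
  have hr : 0 < p.toReal := ENNReal.toReal_pos hp0 hp
  have hwm : Measurable fun x => (g x : ℝ) ^ p.toReal⁻¹ := hgm.coe_nnreal_real.pow_const _
  refine ⟨fun x => (g x : ℝ) ^ p.toReal⁻¹, fun x => Real.rpow_pos_of_pos (hg0 x) _, hwm,
    hwm.aestronglyMeasurable, ?_⟩
  rw [eLpNorm_lt_top_iff_lintegral_rpow_enorm_lt_top hp0 hp]
  refine lt_of_le_of_lt (le_of_eq (lintegral_congr fun x => ?_)) (hg.trans ENNReal.one_lt_top)
  rw [Real.enorm_eq_ofReal (by positivity), ENNReal.ofReal_rpow_of_nonneg (by positivity) hr.le,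
    ← Real.rpow_mul (by positivity), inv_mul_cancel₀ hr.ne', Real.rpow_one,
    ENNReal.ofReal_coe_nnreal]

variable {p q : ℝ≥0∞}

theorem memLp_simpleFunc_mul {w : α → ℝ} (hw : MemLp w p μ) (φ : SimpleFunc α ℝ) :
    MemLp (fun x => φ x * w x) p μ := by
  obtain ⟨C, hC⟩ := φ.exists_forall_norm_le
  exact (hw.const_mul C).of_le (φ.aestronglyMeasurable.mul hw.1) (Eventually.of_forall fun x => by
    rw [norm_mul, norm_mul]
    gcongr
    exact (hC x).trans (le_abs_self C))

theorem integrable_simpleFunc_mul {g : α → ℝ} (hg : Integrable g μ) (φ : SimpleFunc α ℝ) :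
    Integrable (fun x => φ x * g x) μ := by
  obtain ⟨C, hC⟩ := φ.exists_forall_norm_le
  exact hg.bdd_mul φ.aestronglyMeasurable (Eventually.of_forall hC)

variable [Fact (1 ≤ p)]

/-- The values of a functional on the multiples of a fixed `w ∈ L^p` by indicator functions form a
signed measure. -/
noncomputable def dualSignedMeasure (hp : p ≠ ⊤) (ℓ : StrongDual ℝ (Lp ℝ p μ)) {w : α → ℝ}
    (hw : MemLp w p μ) : SignedMeasure α := by
  classical
  exact
  { measureOf' := fun s =>
      if hs : MeasurableSet s then ℓ ((hw.indicator hs).toLp (s.indicator w)) else 0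
    empty' := by
      have h : (hw.indicator MeasurableSet.empty).toLp ((∅ : Set α).indicator w) = 0 := by
        refine Lp.ext ((MemLp.coeFn_toLp _).trans ?_)
        rw [Set.indicator_empty]
        exact (Lp.coeFn_zero ℝ p μ).symm
      rw [dif_pos MeasurableSet.empty, h, map_zero]
    not_measurable' := fun s hs => dif_neg hs
    m_iUnion' := fun f hf hd => by
      simp only [dif_pos (hf _), dif_pos (MeasurableSet.iUnion hf)]
      exact (hasSum_toLp_indicator hp hw hf hd).mapL ℓ }

theorem dualSignedMeasure_apply (hp : p ≠ ⊤) (ℓ : StrongDual ℝ (Lp ℝ p μ)) {w : α → ℝ}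
    (hw : MemLp w p μ) {s : Set α} (hs : MeasurableSet s) :
    dualSignedMeasure hp ℓ hw s = ℓ ((hw.indicator hs).toLp (s.indicator w)) :=
  dif_pos hs

/-- Radon-Nikodym: a functional on `L^p` is given by an integral on the multiples of a fixed
`w ∈ L^p` by simple functions. -/
theorem exists_integrable_dual_simpleFunc_mul [SigmaFinite μ] (hp : p ≠ ⊤)
    (ℓ : StrongDual ℝ (Lp ℝ p μ)) {w : α → ℝ} (hw : MemLp w p μ) :
    ∃ g : α → ℝ, Measurable g ∧ Integrable g μ ∧ ∀ φ : SimpleFunc α ℝ,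
      ℓ ((memLp_simpleFunc_mul hw φ).toLp _) = ∫ x, φ x * g x ∂μ := by
  set s := dualSignedMeasure hp ℓ hw with hs
  have hac : s ≪ᵥ μ.toENNRealVectorMeasure := by
    refine VectorMeasure.AbsolutelyContinuous.mk fun A hA h0 => ?_
    rw [Measure.toENNRealVectorMeasure_apply_measurable hA] at h0
    rw [hs, dualSignedMeasure_apply hp ℓ hw hA]
    have h : (hw.indicator hA).toLp (A.indicator w) = 0 :=
      Lp.ext ((MemLp.coeFn_toLp _).trans ((indicator_meas_zero h0).trans
        (Lp.coeFn_zero ℝ p μ).symm))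
    rw [h, map_zero]
  have hint : Integrable (s.rnDeriv μ) μ := SignedMeasure.integrable_rnDeriv s μ
  refine ⟨s.rnDeriv μ, SignedMeasure.measurable_rnDeriv s μ, hint, fun φ => ?_⟩
  induction φ using SimpleFunc.induction with
  | const c hA =>
    rename_i A
    have h1 : (memLp_simpleFunc_mul hw (SimpleFunc.piecewise A hA (SimpleFunc.const α c)
        (SimpleFunc.const α 0))).toLp _ = c • (hw.indicator hA).toLp (A.indicator w) := by
      rw [← MemLp.toLp_const_smul]
      refine (MemLp.toLp_eq_toLp_iff _ _).2 (Eventually.of_forall fun x => ?_)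
      by_cases hx : x ∈ A <;> simp [hx]
    rw [h1, map_smul, ← dualSignedMeasure_apply hp ℓ hw hA, ← hs,
      ← SignedMeasure.withDensityᵥ_rnDeriv_eq s μ hac, withDensityᵥ_apply hint hA,
      smul_eq_mul, SignedMeasure.withDensityᵥ_rnDeriv_eq s μ hac, ← integral_const_mul,
      ← integral_indicator hA]
    refine integral_congr_ae (Eventually.of_forall fun x => ?_)
    by_cases hx : x ∈ A <;> simp [hx]
  | add _ ih₁ ih₂ =>
    rename_i φ₁ φ₂ _
    have h1 : (memLp_simpleFunc_mul hw (φ₁ + φ₂)).toLp _ =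
        (memLp_simpleFunc_mul hw φ₁).toLp _ + (memLp_simpleFunc_mul hw φ₂).toLp _ := by
      rw [← MemLp.toLp_add]
      refine (MemLp.toLp_eq_toLp_iff _ _).2 (Eventually.of_forall fun x => ?_)
      simp [add_mul]
    rw [h1, map_add, ih₁, ih₂, ← integral_add (integrable_simpleFunc_mul hint _)
      (integrable_simpleFunc_mul hint _)]
    simp [add_mul]

/-- A function in `L^p` is a limit of multiples of a positive `w ∈ L^p` by simple functions. -/
theorem exists_tendsto_simpleFunc_mul (hp : p ≠ ⊤) {w : α → ℝ} (hw0 : ∀ x, 0 < w x)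
    (hwm : Measurable w) (hw : MemLp w p μ) (f : Lp ℝ p μ) :
    ∃ φ : ℕ → SimpleFunc α ℝ,
      Tendsto (fun k => (memLp_simpleFunc_mul hw (φ k)).toLp _) atTop (𝓝 f) := by
  have hfm : Measurable f := (Lp.stronglyMeasurable f).measurable
  have hhm : Measurable fun x => f x / w x := hfm.div hwm
  refine ⟨fun k => SimpleFunc.approxOn _ hhm Set.univ 0 (Set.mem_univ 0) k, ?_⟩
  have h1 : (Lp.memLp f).toLp f = f := Lp.toLp_coeFn f (Lp.memLp f)
  refine Eq.subst (motive := fun F => Tendsto _ atTop (𝓝 F)) h1 ?_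
  rw [Lp.tendsto_Lp_iff_tendsto_eLpNorm'']
  refine tendsto_eLpNorm_zero_of_dominated (zero_lt_one.trans_le Fact.out).ne' hp (G := f)
    (fun k => ((memLp_simpleFunc_mul hw _).sub (Lp.memLp f)).1) (Lp.memLp f)
    (fun k => Eventually.of_forall fun x => ?_) (Eventually.of_forall fun x => ?_)
  · have h2 := SimpleFunc.nnnorm_approxOn_le hhm (Set.mem_univ (0 : ℝ)) x k
    rw [sub_zero, ← NNReal.coe_le_coe, coe_nnnorm, coe_nnnorm] at h2
    have h3 : f x = f x / w x * w x := (div_mul_cancel₀ _ (hw0 x).ne').symm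
    rw [Pi.sub_apply]
    calc _ = ‖(SimpleFunc.approxOn _ hhm Set.univ 0 (Set.mem_univ 0) k x - f x / w x) * w x‖ := by
          rw [sub_mul, ← h3]
      _ ≤ ‖f x / w x‖ * ‖w x‖ := by
          rw [norm_mul]
          gcongr
      _ = ‖f x‖ := by rw [← norm_mul, ← h3]
  · have h2 := SimpleFunc.tendsto_approxOn hhm (Set.mem_univ (0 : ℝ)) (x := x) (by simp)
    have h4 := (h2.mul_const (w x)).sub_const (f x)
    rw [div_mul_cancel₀ _ (hw0 x).ne', sub_self] at h4
    exact h4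

/-- The bound for the density of a functional on `L^p`: the functional is tested on simple
functions increasing to `|g| ^ (q - 1)`. -/
theorem eLpNorm_le_of_dual_simpleFunc_mul [p.HolderConjugate q] (hp1 : p ≠ 1) (hp : p ≠ ⊤)
    (ℓ : StrongDual ℝ (Lp ℝ p μ)) {w g : α → ℝ} (hw0 : ∀ x, 0 < w x) (hwm : Measurable w)
    (hw : MemLp w p μ) (hgm : Measurable g) (hgi : Integrable (fun x => w x * g x) μ)
    (hℓ : ∀ φ : SimpleFunc α ℝ,
      ℓ ((memLp_simpleFunc_mul hw φ).toLp _) = ∫ x, φ x * (w x * g x) ∂μ) :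
    eLpNorm g q μ ≤ ‖ℓ‖ₑ := by
  have hp0 : p ≠ 0 := (zero_lt_one.trans_le Fact.out).ne'
  have hq0 : q ≠ 0 := ENNReal.HolderConjugate.ne_zero q p
  have hq : q ≠ ⊤ := (ENNReal.HolderConjugate.ne_top_iff_ne_one q p).2 hp1
  have hc : p.toReal.HolderConjugate q.toReal :=
    ENNReal.HolderConjugate.toReal_of_ne_top hp hq
  set r := p.toReal
  set r' := q.toReal
  have hr0 : 0 < r := hc.pos
  have hr0' : 0 < r' := hc.symm.pos
  have hr1 : 0 < r - 1 := hc.sub_one_pos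
  have hr1' : 0 < r' - 1 := hc.symm.sub_one_pos
  have hW0 : ∀ x, ‖w x‖ₑ ≠ 0 := fun x => by simpa using (hw0 x).ne'
  -- `F` is chosen such that `F * w` is the function `|g| ^ (q - 1)`, whose `L^p` norm to the power
  -- `p` and whose integral against `|g|` are both the integral of `|g| ^ q`.
  set F : α → ℝ≥0∞ := fun x => ‖g x‖ₑ ^ (r' - 1) / ‖w x‖ₑ with hF
  have hFm : Measurable F := (hgm.enorm.pow_const _).div hwm.enorm
  set a := SimpleFunc.eapprox F with ha
  have haF : ∀ k x, a k x * ‖w x‖ₑ ≤ ‖g x‖ₑ ^ (r' - 1) := by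
    intro k x
    rw [← ENNReal.le_div_iff_mul_le (Or.inl (hW0 x)) (Or.inl enorm_ne_top)]
    exact (le_iSup (fun k => a k x) k).trans (SimpleFunc.iSup_eapprox_apply hFm x).le
  -- `σ` is the sign of `g`.
  set σ : SimpleFunc α ℝ := SimpleFunc.piecewise {x | 0 ≤ g x}
    (measurableSet_le measurable_const hgm) (SimpleFunc.const α 1) (SimpleFunc.const α (-1)) with hσ
  have hσg : ∀ x, σ x * g x = |g x| := by
    intro x
    by_cases hx : 0 ≤ g x
    · simp [hσ, hx, abs_of_nonneg hx]
    · simp [hσ, hx, abs_of_neg (not_le.1 hx)]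
  have hσ1 : ∀ x, ‖σ x‖ₑ = 1 := by
    intro x
    by_cases hx : 0 ≤ g x <;> simp [hσ, hx]
  set φ : ℕ → SimpleFunc α ℝ := fun k => σ * (a k).map ENNReal.toReal with hφ
  have hφa : ∀ k x, φ k x = σ x * (a k x).toReal := fun k x => rfl
  have hat : ∀ k x, a k x ≠ ⊤ := fun k x => (SimpleFunc.eapprox_lt_top F k x).ne
  have hφe : ∀ k x, ‖φ k x * w x‖ₑ = a k x * ‖w x‖ₑ := by
    intro k x
    rw [hφa, enorm_mul, enorm_mul, hσ1, one_mul, Real.enorm_of_nonneg ENNReal.toReal_nonneg,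
      ENNReal.ofReal_toReal (hat k x)]
  set I : ℕ → ℝ≥0∞ := fun k => ∫⁻ x, (a k x * ‖w x‖ₑ) ^ r ∂μ with hI
  have hnorm : ∀ k, eLpNorm (fun x => φ k x * w x) p μ = I k ^ (1 / r) := by
    intro k
    simp only [eLpNorm_eq_lintegral_rpow_enorm_toReal hp0 hp, hφe, hI, r]
  -- The factor `I k ^ (1 / r)` may be cancelled below since `I k` is finite.
  have hItop : ∀ k, I k ≠ ⊤ := by
    intro k htop
    have h := (memLp_simpleFunc_mul hw (φ k)).2
    rw [hnorm, htop, ENNReal.top_rpow_of_pos (by positivity)] at h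
    exact lt_irrefl _ h
  have hpair : ∀ k, ENNReal.ofReal (∫ x, φ k x * (w x * g x) ∂μ) =
      ∫⁻ x, a k x * (‖w x‖ₑ * ‖g x‖ₑ) ∂μ := by
    intro k
    have h1 : ∀ x, φ k x * (w x * g x) = (a k x).toReal * (w x * |g x|) := by
      intro x
      rw [hφa, ← hσg]
      ring
    have h2 := integrable_simpleFunc_mul hgi (φ k)
    rw [ofReal_integral_eq_lintegral_ofReal h2 (Eventually.of_forall fun x => by
      simp only [h1, Pi.zero_apply]
      have := (hw0 x).le
      positivity)]
    refine lintegral_congr fun x => ?_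
    rw [h1, ENNReal.ofReal_mul ENNReal.toReal_nonneg, ENNReal.ofReal_toReal (hat k x),
      ENNReal.ofReal_mul (hw0 x).le, Real.enorm_of_nonneg (hw0 x).le, Real.enorm_eq_ofReal_abs]
  have hIle : ∀ k, I k ≤ ‖ℓ‖ₑ * I k ^ (1 / r) := by
    intro k
    calc I k ≤ ∫⁻ x, a k x * (‖w x‖ₑ * ‖g x‖ₑ) ∂μ := by
          refine lintegral_mono fun x => ?_
          calc (a k x * ‖w x‖ₑ) ^ r
              = (a k x * ‖w x‖ₑ) * (a k x * ‖w x‖ₑ) ^ (r - 1) := by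
                conv_rhs => enter [1]; rw [← ENNReal.rpow_one (a k x * ‖w x‖ₑ)]
                rw [← ENNReal.rpow_add_of_nonneg _ _ zero_le_one hr1.le, add_sub_cancel]
            _ ≤ (a k x * ‖w x‖ₑ) * (‖g x‖ₑ ^ (r' - 1)) ^ (r - 1) := by
                gcongr
                exact haF k x
            _ = a k x * (‖w x‖ₑ * ‖g x‖ₑ) := by
                have h1 : (r' - 1) * (r - 1) = 1 := by
                  have := hc.mul_eq_add
                  linarith
                rw [← ENNReal.rpow_mul, h1, ENNReal.rpow_one, mul_assoc]
      _ = ENNReal.ofReal (ℓ ((memLp_simpleFunc_mul hw (φ k)).toLp _)) := by rw [hℓ, hpair]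
      _ ≤ ‖ℓ ((memLp_simpleFunc_mul hw (φ k)).toLp _)‖ₑ := by
          rw [Real.enorm_eq_ofReal_abs]
          exact ENNReal.ofReal_le_ofReal (le_abs_self _)
      _ ≤ ‖ℓ‖ₑ * ‖(memLp_simpleFunc_mul hw (φ k)).toLp _‖ₑ := ℓ.le_opENorm _
      _ = ‖ℓ‖ₑ * I k ^ (1 / r) := by rw [Lp.enorm_toLp, hnorm]
  have hIbound : ∀ k, I k ≤ ‖ℓ‖ₑ ^ r' := by
    intro k
    rcases eq_or_ne (I k) 0 with h0 | h0
    · rw [h0]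
      exact zero_le
    have h1 : I k ^ (1 / r') ≤ ‖ℓ‖ₑ := by
      have h2 : I k ^ (1 / r') = I k / I k ^ (1 / r) := by
        have h3 : 1 / r' = 1 - 1 / r := by
          have := hc.inv_add_inv_eq_one
          rw [one_div, one_div]
          linarith
        rw [h3, ENNReal.rpow_sub _ _ h0 (hItop k), ENNReal.rpow_one]
      rw [h2]
      exact ENNReal.div_le_of_le_mul (hIle k)
    calc I k = (I k ^ (1 / r')) ^ r' := by
          rw [← ENNReal.rpow_mul, one_div_mul_cancel hr0'.ne', ENNReal.rpow_one]
      _ ≤ ‖ℓ‖ₑ ^ r' := by gcongr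
  have hG : ∀ x, ‖g x‖ₑ ^ r' = ⨆ k, (a k x * ‖w x‖ₑ) ^ r := by
    intro x
    have h1 : ‖g x‖ₑ ^ (r' - 1) = ⨆ k, a k x * ‖w x‖ₑ := by
      rw [← ENNReal.iSup_mul, SimpleFunc.iSup_eapprox_apply hFm x, hF]
      exact (ENNReal.div_mul_cancel (hW0 x) enorm_ne_top).symm
    have h2 : r' = (r' - 1) * r := by
      have := hc.mul_eq_add
      linarith
    conv_lhs => rw [h2, ENNReal.rpow_mul, h1]
    exact (ENNReal.orderIsoRpow r hr0).map_iSup _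
  have hGint : ∫⁻ x, ‖g x‖ₑ ^ r' ∂μ ≤ ‖ℓ‖ₑ ^ r' := by
    simp only [hG]
    have hmeas : ∀ k, Measurable fun x => (a k x * ‖w x‖ₑ) ^ r := fun k =>
      ((a k).measurable.mul hwm.enorm).pow_const r
    rw [lintegral_iSup hmeas]
    · exact iSup_le hIbound
    · intro k k' h x
      simp only
      gcongr
      exact SimpleFunc.monotone_eapprox F h x
  rw [eLpNorm_eq_lintegral_rpow_enorm_toReal hq0 hq]
  calc (∫⁻ x, ‖g x‖ₑ ^ r' ∂μ) ^ (1 / r') ≤ (‖ℓ‖ₑ ^ r') ^ (1 / r') := by gcongr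
    _ = ‖ℓ‖ₑ := by rw [← ENNReal.rpow_mul, mul_one_div_cancel hr0'.ne', ENNReal.rpow_one]

/-- The **Riesz representation theorem** for `L^p`, `1 < p < ∞`. -/
theorem exists_eq_lpPairing [SigmaFinite μ] [Fact (1 ≤ q)] [p.HolderConjugate q] (hp1 : p ≠ 1)
    (hp : p ≠ ⊤) (ℓ : StrongDual ℝ (Lp ℝ p μ)) :
    ∃ g : Lp ℝ q μ, ‖g‖ ≤ ‖ℓ‖ ∧ ∀ f : Lp ℝ p μ, ℓ f = ∫ x, f x * g x ∂μ := by
  have hp0 : p ≠ 0 := (zero_lt_one.trans_le Fact.out).ne'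
  obtain ⟨w, hw0, hwm, hw⟩ := exists_pos_memLp (μ := μ) hp0 hp
  obtain ⟨g₁, hg₁m, hg₁, hℓ⟩ := exists_integrable_dual_simpleFunc_mul hp ℓ hw
  have hwg : ∀ x, w x * (g₁ x / w x) = g₁ x := fun x => mul_div_cancel₀ _ (hw0 x).ne'
  have hgm : Measurable fun x => g₁ x / w x := hg₁m.div hwm
  have hbound : eLpNorm (fun x => g₁ x / w x) q μ ≤ ‖ℓ‖ₑ :=
    eLpNorm_le_of_dual_simpleFunc_mul hp1 hp ℓ hw0 hwm hw hgm (by simpa only [hwg] using hg₁)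
      (by simpa only [hwg] using hℓ)
  have hg : MemLp (fun x => g₁ x / w x) q μ :=
    ⟨hgm.aestronglyMeasurable, hbound.trans_lt enorm_lt_top⟩
  refine ⟨hg.toLp _, ?_, fun f => ?_⟩
  · rw [Lp.norm_toLp, ← toReal_enorm ℓ]
    exact ENNReal.toReal_mono enorm_ne_top hbound
  · obtain ⟨φ, hφ⟩ := exists_tendsto_simpleFunc_mul hp hw0 hwm hw f
    have h1 := (ℓ.continuous.tendsto f).comp hφ
    have h2 := ((((ContinuousLinearMap.mul ℝ ℝ).lpPairing μ p q).flip
      (hg.toLp _)).continuous.tendsto f).comp hφ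
    simp only [Function.comp_def, ContinuousLinearMap.flip_apply,
      ContinuousLinearMap.lpPairing_eq_integral, ContinuousLinearMap.mul_apply'] at h1 h2
    refine tendsto_nhds_unique h1 (h2.congr fun k => ?_)
    rw [hℓ]
    refine integral_congr_ae ?_
    filter_upwards [hg.coeFn_toLp, (memLp_simpleFunc_mul hw (φ k)).coeFn_toLp] with x h3 h4
    rw [h3, h4, mul_assoc, hwg]

end LpDual

/-! ### Translations and weak derivatives -/

section Translation

variable {E : Type*} [NormedAddCommGroup E] [NormedSpace ℝ E] [FiniteDimensional ℝ E]
  [MeasurableSpace E] [BorelSpace E] {μ : Measure E} [μ.IsAddHaarMeasure]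

theorem enorm_integral_mul_le {α : Type*} {m : MeasurableSpace α} {μ : Measure α} {p q : ℝ≥0∞}
    [p.HolderConjugate q] {f g : α → ℝ} (hf : AEStronglyMeasurable f μ)
    (hg : AEStronglyMeasurable g μ) :
    ‖∫ x, f x * g x ∂μ‖ₑ ≤ eLpNorm f p μ * eLpNorm g q μ := by
  refine (enorm_integral_le_lintegral_enorm _).trans ?_
  rw [← eLpNorm_one_eq_lintegral_enorm]
  exact (eLpNorm_smul_le_mul_eLpNorm (p := p) (q := q) (r := 1) hg hf :)

/-- Test functions detect the `L^p` norm. By density they bound the functional on `L^q` given by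
`f`, and the Riesz representation theorem bounds its density, which is `f`. -/
theorem eLpNorm_le_of_forall_test {p q : ℝ≥0∞} [Fact (1 ≤ p)] [Fact (1 ≤ q)] [p.HolderConjugate q]
    (hp1 : p ≠ 1) (hp : p ≠ ⊤) {f : E → ℝ} (hf : MemLp f p μ) {C : ℝ≥0∞}
    (hC : ∀ φ : E → ℝ, ContDiff ℝ ∞ φ → HasCompactSupport φ →
      ‖∫ x, f x * φ x ∂μ‖ₑ ≤ C * eLpNorm φ q μ) : eLpNorm f p μ ≤ C := by
  have hq1 : q ≠ 1 := (ENNReal.HolderConjugate.ne_top_iff_ne_one p q).1 hp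
  have hq : q ≠ ⊤ := (ENNReal.HolderConjugate.ne_top_iff_ne_one q p).2 hp1
  have : q.HolderConjugate p := .symm
  rcases eq_or_ne C ⊤ with rfl | hCtop
  · exact le_top
  lift C to NNReal using hCtop
  set ℓ : StrongDual ℝ (Lp ℝ q μ) := (ContinuousLinearMap.mul ℝ ℝ).lpPairing μ p q hf.toLp with hℓ
  have hℓf : ∀ h : Lp ℝ q μ, ℓ h = ∫ x, f x * h x ∂μ := by
    intro h
    rw [hℓ, ContinuousLinearMap.lpPairing_eq_integral]
    refine integral_congr_ae ?_
    filter_upwards [hf.coeFn_toLp] with x hx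
    rw [hx, ContinuousLinearMap.mul_apply']
  have hbound : ‖ℓ‖ ≤ C := by
    refine ℓ.opNorm_le_bound C.2 fun h => ?_
    refine closure_minimal (t := {h | ‖ℓ h‖ ≤ C * ‖h‖}) ?_
      (isClosed_le ℓ.continuous.norm (continuous_const.mul continuous_norm))
      (Lp.dense_hasCompactSupport_contDiff (F := ℝ) (μ := μ) hq h)
    rintro h ⟨φ, hφ, hφc, hφs⟩
    have h1 : ∫ x, f x * h x ∂μ = ∫ x, f x * φ x ∂μ :=
      integral_congr_ae (hφ.mono fun x hx => by simp only [hx])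
    have h2 := hC φ hφs hφc
    rw [← h1, ← hℓf, ← eLpNorm_congr_ae hφ, ← Lp.enorm_def] at h2
    have h3 := ENNReal.toReal_mono (ENNReal.mul_ne_top ENNReal.coe_ne_top enorm_ne_top) h2
    simpa using h3
  obtain ⟨g, hg, hℓg⟩ := exists_eq_lpPairing (p := q) (q := p) hq1 hq ℓ
  have hp1' : 1 ≤ p := Fact.out
  have hfg : f =ᵐ[μ] g := by
    refine ae_eq_of_integral_contDiff_smul_eq (hf.locallyIntegrable hp1')
      ((Lp.memLp g).locallyIntegrable hp1') fun φ hφ hφc => ?_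
    have hφq : MemLp φ q μ := hφ.continuous.memLp_of_hasCompactSupport hφc
    have h := (hℓf hφq.toLp).symm.trans (hℓg hφq.toLp)
    have h1 : ∫ x, φ x • f x ∂μ = ∫ x, f x * hφq.toLp φ x ∂μ :=
      integral_congr_ae (hφq.coeFn_toLp.mono fun x hx => by simp [hx, mul_comm])
    have h2 : ∫ x, φ x • g x ∂μ = ∫ x, hφq.toLp φ x * g x ∂μ :=
      integral_congr_ae (hφq.coeFn_toLp.mono fun x hx => by simp [hx])
    rw [h1, h2, h]
  rw [eLpNorm_congr_ae hfg, ← Lp.enorm_def, ← ofReal_norm, ← ENNReal.ofReal_coe_nnreal]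
  exact ENNReal.ofReal_le_ofReal (hg.trans hbound)

/-- The integral of a locally integrable function against the translates of a test function can be
differentiated along a line. -/
theorem hasDerivAt_integral_mul_translate {u φ : E → ℝ} (hu : LocallyIntegrable u μ)
    (hφ : ContDiff ℝ ∞ φ) (hc : HasCompactSupport φ) (y : E) (s : ℝ) :
    HasDerivAt (fun s : ℝ => ∫ x, u x * φ (x - s • y) ∂μ)
      (-∫ x, u x * fderiv ℝ φ (x - s • y) y ∂μ) s := by
  -- The integral is the convolution of `u` with the reflection of `φ`, at the point `s • y`.
  have hψ : ContDiff ℝ ∞ fun z => φ (-z) := hφ.comp contDiff_neg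
  have hψc : HasCompactSupport fun z => φ (-z) := hc.comp_homeomorph (Homeomorph.neg E)
  have h1 := hψc.hasFDerivAt_convolution_right (ContinuousLinearMap.mul ℝ ℝ) hu
    (hψ.of_le (by exact_mod_cast le_top)) (s • y)
  have h2 : HasDerivAt (fun s : ℝ => s • y) y s := by
    simpa using (hasDerivAt_id s).smul_const y
  have h3 := h1.comp_hasDerivAt s h2
  have hψ' : Continuous (fderiv ℝ fun z => φ (-z)) := hψ.continuous_fderiv (by simp)
  rw [convolution_precompR_apply _ hu (hψc.fderiv ℝ) hψ'] at h3
  refine (h3.congr_deriv ?_).congr_of_eventuallyEq (Eventually.of_forall fun s => ?_)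
  · rw [convolution_def, ← integral_neg]
    refine integral_congr_ae (Eventually.of_forall fun x => ?_)
    have h4 : fderiv ℝ (fun z => φ (-z)) (s • y - x) y = -fderiv ℝ φ (x - s • y) y := by
      have h5 := ((hφ.differentiable (by simp)) (-(s • y - x))).hasFDerivAt.comp (s • y - x)
        (hasFDerivAt_id (𝕜 := ℝ) (s • y - x)).neg
      rw [neg_sub] at h5
      rw [show fderiv ℝ (fun z => φ (-z)) (s • y - x) = _ from h5.fderiv]
      simp
    simp only [ContinuousLinearMap.mul_apply', h4, mul_neg]
  · simp [convolution_def]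

end Translation

section WeakDerivative

variable {n : ℕ} {p : ℝ≥0∞}

local notation "𝔼" => EuclideanSpace ℝ (Fin n)

theorem memLp_comp_add_right {u : 𝔼 → ℝ} (hu : MemLp u p volume) (y : 𝔼) :
    MemLp (fun x => u (x + y)) p volume :=
  hu.comp_measurePreserving (measurePreserving_add_right volume y)

theorem fderiv_apply_eq_sum (φ : 𝔼 → ℝ) (x y : 𝔼) :
    fderiv ℝ φ x y = ∑ i, y i * fderiv ℝ φ x (EuclideanSpace.single i 1) := by
  conv_lhs => rw [← (EuclideanSpace.basisFun (Fin n) ℝ).sum_repr y]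
  simp

theorem integral_translate_sub_mul {u φ : 𝔼 → ℝ} (hu : LocallyIntegrable u volume)
    (hφ : Continuous φ) (hc : HasCompactSupport φ) (y : 𝔼) :
    ∫ x, (u (x + y) - u x) * φ x = (∫ x, u x * φ (x - y)) - ∫ x, u x * φ x := by
  have hφy : HasCompactSupport fun x => φ (x - y) := hc.comp_homeomorph (Homeomorph.subRight y)
  have h1 : ∫ x, u (x + y) * φ x = ∫ x, u x * φ (x - y) := by
    rw [← integral_add_right_eq_self (fun x => u x * φ (x - y)) y]
    simp
  have hi : Integrable (fun x => u (x + y) * φ x) volume := by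
    have := (integrable_mul_test hu (hφ.comp (continuous_sub_right y)) hφy).comp_add_right y
    simpa using this
  rw [← h1, ← integral_sub hi (integrable_mul_test hu hφ hc)]
  simp only [sub_mul]

variable [Fact (1 ≤ p)]

/-- Translation by `y` moves a Sobolev function by at most `∑ᵢ |yᵢ| ‖∂ᵢu‖` in `L^p`. This is
the mean value inequality for `s ↦ ∫ u φ(· - s y)`, for each test function `φ`. -/
theorem eLpNorm_translate_sub_le (hp1 : p ≠ 1) (hp : p ≠ ⊤) {u : 𝔼 → ℝ} {g : Fin n → 𝔼 → ℝ}
    (hu : MemLp u p volume) (hg : ∀ i, MemLp (g i) p volume)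
    (h : ∀ i, HasWeakPartialDeriv i u (g i)) (y : 𝔼) :
    eLpNorm (fun x => u (x + y) - u x) p volume ≤ ∑ i, ‖y i‖ₑ * eLpNorm (g i) p volume := by
  have hul : LocallyIntegrable u volume := hu.locallyIntegrable Fact.out
  obtain ⟨q, hpq⟩ : ∃ q, p.HolderConjugate q := ⟨_, .conjExponent Fact.out⟩
  have : Fact (1 ≤ q) := ⟨ENNReal.HolderConjugate.one_le q p⟩
  refine eLpNorm_le_of_forall_test (q := q) hp1 hp ((memLp_comp_add_right hu y).sub hu)
    fun φ hφ hc => ?_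
  change ‖∫ x, (u (x + y) - u x) * φ x‖ₑ ≤ _
  rw [integral_translate_sub_mul hul hφ.continuous hc]
  have hφq : MemLp φ q volume := hφ.continuous.memLp_of_hasCompactSupport hc
  have htop : (∑ i, ‖y i‖ₑ * eLpNorm (g i) p volume) * eLpNorm φ q volume ≠ ⊤ :=
    ENNReal.mul_ne_top (ENNReal.sum_ne_top.2 fun i _ =>
      ENNReal.mul_ne_top enorm_ne_top (hg i).eLpNorm_ne_top) hφq.eLpNorm_ne_top
  have hderiv : ∀ s : ℝ, ‖-∫ x, u x * fderiv ℝ φ (x - s • y) y‖ ≤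
      ((∑ i, ‖y i‖ₑ * eLpNorm (g i) p volume) * eLpNorm φ q volume).toReal := by
    intro s
    have hφs : ContDiff ℝ ∞ fun x => φ (x - s • y) := hφ.comp (contDiff_id.sub contDiff_const)
    have hφsc : HasCompactSupport fun x => φ (x - s • y) :=
      hc.comp_homeomorph (Homeomorph.subRight (s • y))
    have h1 : ∀ x, fderiv ℝ φ (x - s • y) y = ∑ i, y i *
        fderiv ℝ (fun x => φ (x - s • y)) x (EuclideanSpace.single i 1) := by
      intro x
      rw [← fderiv_apply_eq_sum, fderiv_comp_sub]
    have h2 : -∫ x, u x * fderiv ℝ φ (x - s • y) y =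
        ∑ i, y i * ∫ x, g i x * φ (x - s • y) := by
      simp only [h1, Finset.mul_sum]
      rw [integral_finsetSum, ← Finset.sum_neg_distrib]
      · refine Finset.sum_congr rfl fun i _ => ?_
        simp only [mul_left_comm _ (y i)]
        rw [integral_const_mul, (h i).2.2 _ hφs hφsc]
        ring
      · intro i _
        simp only [mul_left_comm _ (y i)]
        exact (integrable_mul_fderiv_test hul hφs hφsc _).const_mul _
    rw [← toReal_enorm]
    refine ENNReal.toReal_mono htop ?_
    rw [h2, Finset.sum_mul]
    refine (enorm_sum_le _ _).trans (Finset.sum_le_sum fun i _ => ?_)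
    rw [enorm_mul, mul_assoc]
    gcongr
    refine (enorm_integral_mul_le (p := p) (q := q) (hg i).1
      hφs.continuous.aestronglyMeasurable).trans (le_of_eq ?_)
    congr 1
    exact eLpNorm_comp_measurePreserving hφq.1 (measurePreserving_sub_right volume (s • y))
  have hmv := convex_univ.norm_image_sub_le_of_norm_hasDerivWithin_le
    (fun s _ => (hasDerivAt_integral_mul_translate hul hφ hc y s).hasDerivWithinAt)
    (fun s _ => hderiv s) (Set.mem_univ (0 : ℝ)) (Set.mem_univ (1 : ℝ))
  simp only [one_smul, zero_smul, sub_zero, norm_one, mul_one] at hmv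
  rw [← ofReal_norm]
  exact (ENNReal.ofReal_le_iff_le_toReal htop).2 hmv

/-- If the difference quotients of `v ∈ L^p` in the direction `eᵢ` are bounded in `L^p`, then `v`
has a weak derivative `∂ᵢv ∈ L^p`: a weak limit point of the difference quotients. -/
theorem exists_hasWeakPartialDeriv_of_eLpNorm_translate_sub_le (hp1 : p ≠ 1) (hp : p ≠ ⊤)
    {v : 𝔼 → ℝ} (hv : MemLp v p volume) {C : NNReal} (i : Fin n)
    (hC : ∀ t : ℝ, eLpNorm (fun x => v (x + t • EuclideanSpace.single i 1) - v x) p volume ≤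
      ‖t‖ₑ * C) :
    ∃ g : Lp ℝ p (volume : Measure 𝔼), ‖g‖ ≤ C ∧ HasWeakPartialDeriv i v g := by
  have hvl : LocallyIntegrable v volume := hv.locallyIntegrable Fact.out
  obtain ⟨q, hpq⟩ : ∃ q, p.HolderConjugate q := ⟨_, .conjExponent Fact.out⟩
  have : Fact (1 ≤ q) := ⟨ENNReal.HolderConjugate.one_le q p⟩
  have hq1 : q ≠ 1 := (ENNReal.HolderConjugate.ne_top_iff_ne_one p q).1 hp
  have hq : q ≠ ⊤ := (ENNReal.HolderConjugate.ne_top_iff_ne_one q p).2 hp1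
  have : q.HolderConjugate p := .symm
  set e : 𝔼 := EuclideanSpace.single i 1 with he
  set t : ℕ → ℝ := fun k => 1 / ((k : ℝ) + 1) with ht
  have ht0 : ∀ k, t k ≠ 0 := fun k => (Nat.one_div_pos_of_nat (α := ℝ)).ne'
  have hD : ∀ k, MemLp (fun x => (t k)⁻¹ * (v (x + t k • e) - v x)) p volume := fun k =>
    ((memLp_comp_add_right hv _).sub hv).const_mul _
  have hDn : ∀ k, eLpNorm (fun x => (t k)⁻¹ * (v (x + t k • e) - v x)) p volume ≤ C := by
    intro k
    have h1 : eLpNorm (fun x => (t k)⁻¹ * (v (x + t k • e) - v x)) p volume =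
        ‖(t k)⁻¹‖ₑ * eLpNorm (fun x => v (x + t k • e) - v x) p volume :=
      eLpNorm_const_smul (t k)⁻¹ (fun x => v (x + t k • e) - v x) p volume
    rw [h1]
    calc _ ≤ ‖(t k)⁻¹‖ₑ * (‖t k‖ₑ * C) := by gcongr; exact hC _
      _ = C := by
        rw [← mul_assoc, ← enorm_mul, inv_mul_cancel₀ (ht0 k), enorm_one, one_mul]
  set ℓ : ℕ → StrongDual ℝ (Lp ℝ q (volume : Measure 𝔼)) := fun k =>
    (ContinuousLinearMap.mul ℝ ℝ).lpPairing volume p q (hD k).toLp with hℓ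
  have hℓD : ∀ k (h : Lp ℝ q (volume : Measure 𝔼)),
      ℓ k h = ∫ x, ((t k)⁻¹ * (v (x + t k • e) - v x)) * h x := by
    intro k h
    simp only [hℓ]
    rw [ContinuousLinearMap.lpPairing_eq_integral]
    refine integral_congr_ae ?_
    filter_upwards [(hD k).coeFn_toLp] with x hx
    rw [hx, ContinuousLinearMap.mul_apply']
  have hℓn : ∀ k, ‖ℓ k‖ ≤ C := by
    intro k
    refine (ℓ k).opNorm_le_bound C.2 fun h => ?_
    rw [hℓD, ← toReal_enorm, ← toReal_enorm h, ← ENNReal.coe_toReal C, ← ENNReal.toReal_mul]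
    refine ENNReal.toReal_mono (ENNReal.mul_ne_top ENNReal.coe_ne_top enorm_ne_top) ?_
    refine (enorm_integral_mul_le (p := p) (q := q) (hD k).1 (Lp.memLp h).1).trans ?_
    rw [Lp.enorm_def]
    gcongr
    exact hDn k
  -- The Banach-Alaoglu theorem for the difference quotients, as functionals on `L^q`.
  obtain ⟨L, hL, hcl⟩ := (WeakDual.isCompact_closedBall (𝕜 := ℝ)
    (0 : StrongDual ℝ (Lp ℝ q (volume : Measure 𝔼))) C).exists_mapClusterPt
    (f := atTop) (u := fun k => StrongDual.toWeakDual (ℓ k)) (tendsto_principal.2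
      (Eventually.of_forall fun k => by simpa using hℓn k))
  obtain ⟨g, hg, hLg⟩ := exists_eq_lpPairing (p := q) (q := p) hq1 hq (WeakDual.toStrongDual L)
  refine ⟨g, hg.trans (by simpa using hL), hvl, (Lp.memLp g).locallyIntegrable Fact.out,
    fun φ hφ hc => ?_⟩
  have hφq : MemLp φ q volume := hφ.continuous.memLp_of_hasCompactSupport hc
  have hlim : Tendsto (fun k => ℓ k hφq.toLp) atTop (𝓝 (-∫ x, v x * fderiv ℝ φ x e)) := by
    have h1 := hasDerivAt_integral_mul_translate hvl hφ hc e 0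
    simp only [zero_smul, sub_zero] at h1
    have h2 : Tendsto t atTop (𝓝[≠] 0) :=
      tendsto_nhdsWithin_iff.2 ⟨tendsto_one_div_add_atTop_nhds_zero_nat, Eventually.of_forall ht0⟩
    refine (h1.tendsto_slope_zero.comp h2).congr fun k => ?_
    rw [hℓD]
    have h3 : ∫ x, ((t k)⁻¹ * (v (x + t k • e) - v x)) * hφq.toLp φ x =
        ∫ x, (t k)⁻¹ * ((v (x + t k • e) - v x) * φ x) :=
      integral_congr_ae (hφq.coeFn_toLp.mono fun x hx => by simp only [hx, mul_assoc])
    rw [h3, integral_const_mul, integral_translate_sub_mul hvl hφ.continuous hc]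
    simp
  have hcl' : MapClusterPt (L hφq.toLp) atTop (fun k => ℓ k hφq.toLp) :=
    hcl.continuousAt_comp (WeakDual.eval_continuous hφq.toLp).continuousAt
  have hLφ : L hφq.toLp = -∫ x, v x * fderiv ℝ φ x e :=
    eq_of_nhds_neBot (hcl'.clusterPt.mono hlim)
  have h4 : L hφq.toLp = ∫ x, g x * φ x :=
    (hLg hφq.toLp).trans (integral_congr_ae (hφq.coeFn_toLp.mono fun x hx => by
      simp only [hx, mul_comm]))
  rw [← h4, hLφ, neg_neg]

end WeakDerivative

/-! ### Local strong convergence of weakly convergent sequences -/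

section LocalConvergence

variable {n : ℕ} {p : ℝ≥0∞} [Fact (1 ≤ p)]

local notation "𝔼" => EuclideanSpace ℝ (Fin n)

/-- Averaging over translations that move `f` by at most `K` in `L^p` moves `f` by at most `K`. -/
theorem eLpNorm_integral_translate_sub_le (hp : p ≠ ⊤) {ν : Measure 𝔼} [IsProbabilityMeasure ν]
    {f : 𝔼 → ℝ} (hf : StronglyMeasurable f) (hint : ∀ x, Integrable (fun y => f (x + y)) ν)
    {K : ℝ≥0∞} (hK : ∀ᵐ y ∂ν, eLpNorm (fun x => f (x + y) - f x) p volume ≤ K) :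
    eLpNorm (fun x => (∫ y, f (x + y) ∂ν) - f x) p volume ≤ K := by
  have hp1 : 1 ≤ p := Fact.out
  have hp0 : p ≠ 0 := (zero_lt_one.trans_le hp1).ne'
  have hr : 0 < p.toReal := ENNReal.toReal_pos hp0 hp
  have hmeas : Measurable fun z : 𝔼 × 𝔼 => ‖f (z.1 + z.2) - f z.1‖ₑ ^ p.toReal :=
    ((hf.measurable.comp (measurable_fst.add measurable_snd)).sub
      (hf.measurable.comp measurable_fst)).enorm.pow_const _
  -- Jensen's inequality for the probability measure `ν`.
  have hpt : ∀ x, ‖(∫ y, f (x + y) ∂ν) - f x‖ₑ ^ p.toReal ≤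
      ∫⁻ y, ‖f (x + y) - f x‖ₑ ^ p.toReal ∂ν := by
    intro x
    have h1 : (∫ y, f (x + y) ∂ν) - f x = ∫ y, (f (x + y) - f x) ∂ν := by
      rw [integral_sub (hint x) (integrable_const _)]
      simp
    have h2 : ‖∫ y, (f (x + y) - f x) ∂ν‖ₑ ≤ eLpNorm (fun y => f (x + y) - f x) p ν := by
      refine (enorm_integral_le_lintegral_enorm _).trans ?_
      rw [← eLpNorm_one_eq_lintegral_enorm]
      exact eLpNorm_le_eLpNorm_of_exponent_le hp1 ((hint x).sub (integrable_const _)).1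
    rw [h1]
    refine (ENNReal.rpow_le_rpow h2 hr.le).trans (le_of_eq ?_)
    rw [eLpNorm_eq_lintegral_rpow_enorm_toReal hp0 hp, ← ENNReal.rpow_mul,
      one_div_mul_cancel hr.ne', ENNReal.rpow_one]
  rw [eLpNorm_eq_lintegral_rpow_enorm_toReal hp0 hp, one_div,
    ENNReal.rpow_inv_le_iff hr]
  calc ∫⁻ x, ‖(∫ y, f (x + y) ∂ν) - f x‖ₑ ^ p.toReal
      ≤ ∫⁻ x, ∫⁻ y, ‖f (x + y) - f x‖ₑ ^ p.toReal ∂ν := lintegral_mono hpt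
    _ = ∫⁻ y, (∫⁻ x, ‖f (x + y) - f x‖ₑ ^ p.toReal) ∂ν :=
        lintegral_lintegral_swap hmeas.aemeasurable
    _ ≤ ∫⁻ _, K ^ p.toReal ∂ν := by
        refine lintegral_mono_ae (hK.mono fun y hy => ?_)
        rwa [eLpNorm_eq_lintegral_rpow_enorm_toReal hp0 hp, one_div,
          ENNReal.rpow_inv_le_iff hr] at hy
    _ = K ^ p.toReal := by simp

/-- The normalized Lebesgue measure on the ball of radius `ε` centred at the origin. -/
noncomputable def ballMeasure (n : ℕ) (ε : ℝ) : Measure (EuclideanSpace ℝ (Fin n)) :=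
  (volume (Metric.ball (0 : EuclideanSpace ℝ (Fin n)) ε))⁻¹ • volume.restrict (Metric.ball 0 ε)

theorem isProbabilityMeasure_ballMeasure {ε : ℝ} (hε : 0 < ε) :
    IsProbabilityMeasure (ballMeasure n ε) := by
  constructor
  simp only [ballMeasure, Measure.smul_apply, Measure.restrict_apply_univ, smul_eq_mul]
  exact ENNReal.inv_mul_cancel (Metric.measure_ball_pos _ _ hε).ne' measure_ball_lt_top.ne

theorem integrable_ballMeasure {f : 𝔼 → ℝ} (hf : LocallyIntegrable f volume) {ε : ℝ} (hε : 0 < ε)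
    (x : 𝔼) : Integrable (fun y => f (x + y)) (ballMeasure n ε) := by
  refine Integrable.smul_measure ?_
    (ENNReal.inv_ne_top.2 (Metric.measure_ball_pos _ _ hε).ne')
  have h1 : IntegrableOn f (Metric.ball x ε) volume :=
    (hf.integrableOn_isCompact (isCompact_closedBall x ε)).mono_set Metric.ball_subset_closedBall
  have h2 := (measurePreserving_add_left volume x).integrableOn_comp_preimage
    (Homeomorph.addLeft x).measurableEmbedding (f := f) (s := Metric.ball x ε)
  have h3 : (fun y => x + y) ⁻¹' Metric.ball x ε = Metric.ball 0 ε := by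
    ext y; simp
  rw [h3] at h2
  exact h2.2 h1

theorem integral_ballMeasure (f : 𝔼 → ℝ) (ε : ℝ) (x : 𝔼) :
    ∫ y, f (x + y) ∂(ballMeasure n ε) =
      (volume.real (Metric.ball (0 : 𝔼) ε))⁻¹ * ∫ y in Metric.ball x ε, f y := by
  have h3 : (fun y => x + y) ⁻¹' Metric.ball x ε = Metric.ball 0 ε := by
    ext y; simp
  rw [ballMeasure, integral_smul_measure, ← h3,
    (measurePreserving_add_left volume x).setIntegral_preimage_emb
      (Homeomorph.addLeft x).measurableEmbedding, ENNReal.toReal_inv, h3, smul_eq_mul,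
    measureReal_def]

/-- Integration over a set of finite measure, as a functional on `L^p`. -/
theorem exists_dual_setIntegral {α : Type*} {m : MeasurableSpace α} {μ : Measure α} {q : ℝ≥0∞}
    [Fact (1 ≤ q)] [p.HolderConjugate q] {s : Set α} (hs : MeasurableSet s) (hμs : μ s ≠ ⊤) :
    ∃ ℓ : StrongDual ℝ (Lp ℝ p μ), ∀ f : Lp ℝ p μ, ℓ f = ∫ x in s, f x ∂μ := by
  refine ⟨((ContinuousLinearMap.mul ℝ ℝ).lpPairing μ p q).flip (indicatorConstLp q hs hμs 1),
    fun f => ?_⟩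
  rw [ContinuousLinearMap.flip_apply, ContinuousLinearMap.lpPairing_eq_integral,
    ← integral_indicator hs]
  refine integral_congr_ae ?_
  filter_upwards [indicatorConstLp_coeFn (p := q) (hs := hs) (hμs := hμs) (c := (1 : ℝ))] with x hx
  rw [hx, ContinuousLinearMap.mul_apply']
  by_cases hxs : x ∈ s <;> simp [hxs]

/-- The ball averages of a sequence that tends to `0` weakly in `L^p` tend to `0` strongly on sets
of finite measure: they tend to `0` pointwise and are uniformly bounded. -/
theorem tendsto_eLpNorm_ball_average (hp : p ≠ ⊤) {h : ℕ → Lp ℝ p (volume : Measure 𝔼)} {B : NNReal}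
    (hB : ∀ k, ‖h k‖ₑ ≤ B) (hw : ∀ ℓ : StrongDual ℝ (Lp ℝ p (volume : Measure 𝔼)),
      Tendsto (fun k => ℓ (h k)) atTop (𝓝 0)) {ε : ℝ} (hε : 0 < ε) {S : Set 𝔼}
    (hS : volume S ≠ ⊤) :
    Tendsto (fun k => eLpNorm (fun x => ∫ y, h k (x + y) ∂(ballMeasure n ε)) p (volume.restrict S))
      atTop (𝓝 0) := by
  have hp1 : 1 ≤ p := Fact.out
  obtain ⟨q, hpq⟩ : ∃ q, p.HolderConjugate q := ⟨_, .conjExponent hp1⟩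
  have : Fact (1 ≤ q) := ⟨ENNReal.HolderConjugate.one_le q p⟩
  have := isProbabilityMeasure_ballMeasure (n := n) hε
  have hfin : IsFiniteMeasure (volume.restrict S) := isFiniteMeasure_restrict.2 hS
  set V : ℝ := (volume.real (Metric.ball (0 : 𝔼) ε))⁻¹ with hV
  set D : ℝ≥0∞ := B * eLpNorm ((Metric.ball (0 : 𝔼) ε).indicator fun _ => (1 : ℝ)) q volume with hD
  have hDtop : D ≠ ⊤ := ENNReal.mul_ne_top ENNReal.coe_ne_top
    (memLp_indicator_const q measurableSet_ball (1 : ℝ)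
      (Or.inr measure_ball_lt_top.ne)).eLpNorm_ne_top
  have hbound : ∀ k x, ‖∫ y, h k (x + y) ∂(ballMeasure n ε)‖ ≤ ‖V * D.toReal‖ := by
    intro k x
    rw [integral_ballMeasure, norm_mul, norm_mul, ← hV]
    gcongr
    rw [Real.norm_of_nonneg ENNReal.toReal_nonneg, ← toReal_enorm]
    refine ENNReal.toReal_mono hDtop ?_
    have h1 : ∫ y in Metric.ball x ε, h k y =
        ∫ y, h k y * (Metric.ball x ε).indicator (fun _ => (1 : ℝ)) y := by
      rw [← integral_indicator measurableSet_ball]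
      refine integral_congr_ae (Eventually.of_forall fun y => ?_)
      by_cases hy : y ∈ Metric.ball x ε <;> simp [hy]
    have h2 : eLpNorm ((Metric.ball x ε).indicator fun _ => (1 : ℝ)) q volume =
        eLpNorm ((Metric.ball (0 : 𝔼) ε).indicator fun _ => (1 : ℝ)) q volume := by
      have h3 : ((Metric.ball x ε).indicator fun _ => (1 : ℝ)) =
          ((Metric.ball (0 : 𝔼) ε).indicator fun _ => (1 : ℝ)) ∘ fun y => y - x := by
        ext y
        simp [Set.indicator, dist_eq_norm]
      rw [h3]
      exact eLpNorm_comp_measurePreserving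
        (aestronglyMeasurable_const.indicator measurableSet_ball)
        (measurePreserving_sub_right volume x)
    rw [h1]
    refine (enorm_integral_mul_le (p := p) (q := q) (Lp.memLp (h k)).1
      (aestronglyMeasurable_const.indicator measurableSet_ball)).trans ?_
    rw [h2, hD]
    gcongr
    rw [← Lp.enorm_def]
    exact hB k
  refine tendsto_eLpNorm_zero_of_dominated (zero_lt_one.trans_le hp1).ne' hp
    (G := fun _ => V * D.toReal) (fun k => ?_) (memLp_const _)
    (fun k => Eventually.of_forall (hbound k)) (Eventually.of_forall fun x => ?_)
  · have hm : StronglyMeasurable fun z : 𝔼 × 𝔼 => h k (z.1 + z.2) :=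
      (Lp.stronglyMeasurable (h k)).comp_measurable (measurable_fst.add measurable_snd)
    exact hm.integral_prod_right.aestronglyMeasurable
  · obtain ⟨ℓ, hℓ⟩ := exists_dual_setIntegral (p := p) (q := q)
      (measurableSet_ball (x := x) (ε := ε)) (measure_ball_lt_top (μ := volume)).ne
    simp only [integral_ballMeasure, ← hℓ]
    simpa using (hw ℓ).const_mul V

/-- A form of the Rellich-Kondrachov theorem: a sequence bounded in `W^{1,p}` that tends to
`0` weakly in `L^p` tends to `0` strongly on sets of finite measure. -/
theorem tendsto_eLpNorm_restrict_of_weak (hp1 : p ≠ 1) (hp : p ≠ ⊤)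
    {h : ℕ → Lp ℝ p (volume : Measure 𝔼)} {g : ℕ → Fin n → Lp ℝ p (volume : Measure 𝔼)}
    (hg : ∀ k i, HasWeakPartialDeriv i (h k) (g k i)) {B : NNReal} (hB : ∀ k, ‖h k‖ₑ ≤ B)
    (hBg : ∀ k i, ‖g k i‖ₑ ≤ B) (hw : ∀ ℓ : StrongDual ℝ (Lp ℝ p (volume : Measure 𝔼)),
      Tendsto (fun k => ℓ (h k)) atTop (𝓝 0)) {S : Set 𝔼} (hS : volume S ≠ ⊤) :
    Tendsto (fun k => eLpNorm (h k) p (volume.restrict S)) atTop (𝓝 0) := by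
  have hp1' : 1 ≤ p := Fact.out
  rw [ENNReal.tendsto_nhds_zero]
  intro δ hδ
  have hδ2 : 0 < δ / 2 := ENNReal.half_pos hδ.ne'
  obtain ⟨ε, hε, hεδ⟩ : ∃ ε : ℝ, 0 < ε ∧ ∑ _i : Fin n, ENNReal.ofReal ε * B ≤ δ / 2 := by
    have hlim : Tendsto (fun ε : ℝ => ∑ _i : Fin n, ENNReal.ofReal ε * B) (𝓝[>] 0) (𝓝 0) := by
      have h1 : Tendsto (fun ε : ℝ => ENNReal.ofReal ε * B) (𝓝[>] 0) (𝓝 0) := by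
        have h2 : Tendsto (fun ε : ℝ => ENNReal.ofReal ε) (𝓝[>] 0) (𝓝 0) := by
          have := ENNReal.continuous_ofReal.tendsto (0 : ℝ)
          rw [ENNReal.ofReal_zero] at this
          exact this.mono_left nhdsWithin_le_nhds
        simpa using ENNReal.Tendsto.mul_const h2 (Or.inr (ENNReal.coe_ne_top (r := B)))
      simpa using tendsto_finsetSum Finset.univ fun (i : Fin n) _ => h1
    obtain ⟨ε, h1, h2⟩ := ((hlim.eventually (ge_mem_nhds hδ2)).and self_mem_nhdsWithin).exists
    exact ⟨ε, h2, h1⟩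
  have := isProbabilityMeasure_ballMeasure (n := n) hε
  filter_upwards [(ENNReal.tendsto_nhds_zero.1 (tendsto_eLpNorm_ball_average hp hB hw hε hS))
    (δ / 2) hδ2] with k hk
  have hhm := Lp.stronglyMeasurable (h k)
  have hAm : StronglyMeasurable fun x => ∫ y, h k (x + y) ∂(ballMeasure n ε) := by
    have hm : StronglyMeasurable fun z : 𝔼 × 𝔼 => h k (z.1 + z.2) :=
      hhm.comp_measurable (measurable_fst.add measurable_snd)
    exact hm.integral_prod_right
  have hdiff : eLpNorm (fun x => (∫ y, h k (x + y) ∂(ballMeasure n ε)) - h k x) p volume ≤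
      δ / 2 := by
    refine eLpNorm_integral_translate_sub_le hp hhm
      (integrable_ballMeasure ((Lp.memLp (h k)).locallyIntegrable hp1') hε) ?_
    refine Measure.ae_smul_measure ?_ _
    filter_upwards [ae_restrict_mem measurableSet_ball] with y hy
    refine (eLpNorm_translate_sub_le hp1 hp (Lp.memLp (h k)) (fun i => Lp.memLp (g k i))
      (hg k) y).trans (le_trans (Finset.sum_le_sum fun i _ => ?_) hεδ)
    gcongr
    · rw [← ofReal_norm]
      exact ENNReal.ofReal_le_ofReal
        ((PiLp.norm_apply_le y i).trans (mem_ball_zero_iff.1 hy).le)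
    · rw [← Lp.enorm_def]
      exact hBg k i
  have hsplit : (h k : 𝔼 → ℝ) = (fun x => ∫ y, h k (x + y) ∂(ballMeasure n ε)) -
      fun x => (∫ y, h k (x + y) ∂(ballMeasure n ε)) - h k x := by
    ext x
    simp
  calc eLpNorm (h k) p (volume.restrict S)
      ≤ eLpNorm (fun x => ∫ y, h k (x + y) ∂(ballMeasure n ε)) p (volume.restrict S) +
        eLpNorm (fun x => (∫ y, h k (x + y) ∂(ballMeasure n ε)) - h k x) p
          (volume.restrict S) := by
        conv_lhs => rw [hsplit]
        exact eLpNorm_sub_le hAm.aestronglyMeasurable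
          (hAm.sub hhm).aestronglyMeasurable hp1'
    _ ≤ δ / 2 + δ / 2 := by
        gcongr
        exact (eLpNorm_mono_measure _ Measure.restrict_le_self).trans hdiff
    _ = δ := ENNReal.add_halves δ

end LocalConvergence

/-! ### The maximal function of a Sobolev function -/

section MaximalFunction

variable {n : ℕ} {p : ℝ≥0∞}

local notation "𝔼" => EuclideanSpace ℝ (Fin n)

theorem maximalFunction_eq_hlMaximal (f : 𝔼 → ℝ) :
    maximalFunction f = hlMaximal volume fun y => ‖f y‖ₑ := by
  simp only [Real.enorm_eq_ofReal_abs]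
  rfl

theorem measurable_maximalFunction (f : 𝔼 → ℝ) : Measurable (maximalFunction f) := by
  rw [maximalFunction_eq_hlMaximal]
  exact measurable_hlMaximal _

theorem eLpNorm_toReal_maximalFunction_le {C : NNReal}
    (hC : ∀ f : 𝔼 → ℝ, AEStronglyMeasurable f volume →
      eLpNorm (hlMaximal volume fun y => ‖f y‖ₑ) p volume ≤ C * eLpNorm f p volume)
    {f : 𝔼 → ℝ} (hf : AEStronglyMeasurable f volume) :
    eLpNorm (fun x => (maximalFunction f x).toReal) p volume ≤ C * eLpNorm f p volume := by
  refine le_trans (eLpNorm_mono_enorm fun x => ?_) (hC f hf)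
  rw [maximalFunction_eq_hlMaximal, Real.enorm_of_nonneg ENNReal.toReal_nonneg, enorm_eq_self]
  exact ENNReal.ofReal_toReal_le

variable [Fact (1 ≤ p)]

theorem exists_eLpNorm_hlMaximal_le (hn : 1 ≤ n) (hp1 : p ≠ 1) (hp : p ≠ ⊤) :
    ∃ C : NNReal, ∀ f : 𝔼 → ℝ, AEStronglyMeasurable f volume →
      eLpNorm (hlMaximal volume fun y => ‖f y‖ₑ) p volume ≤ C * eLpNorm f p volume := by
  have hp1' : 1 ≤ p := Fact.out
  have hp0 : p ≠ 0 := (zero_lt_one.trans_le hp1').ne'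
  have hr : 1 < p.toReal := by
    rw [← ENNReal.toReal_one]
    exact (ENNReal.toReal_lt_toReal ENNReal.one_ne_top hp).2 (lt_of_le_of_ne hp1' hp1.symm)
  have hr0 : 0 < p.toReal := by linarith
  have : Nonempty (Fin n) := ⟨⟨0, hn⟩⟩
  obtain ⟨C, hC⟩ := exists_lintegral_hlMaximal_rpow_le (volume : Measure 𝔼) hr
  refine ⟨C ^ (1 / p.toReal), fun f hf => ?_⟩
  have hae : (fun y => ‖f y‖ₑ) =ᵐ[volume] fun y => (‖hf.mk f y‖₊ : ℝ≥0∞) :=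
    hf.ae_eq_mk.mono fun y hy => by simp only [hy, enorm_eq_nnnorm]
  have h := hC (fun y => ‖hf.mk f y‖₊) hf.stronglyMeasurable_mk.measurable.nnnorm
  rw [hlMaximal_congr_ae hae, eLpNorm_congr_ae hf.ae_eq_mk]
  simp only [eLpNorm_eq_lintegral_rpow_enorm_toReal hp0 hp, enorm_eq_self]
  rw [ENNReal.coe_rpow_of_nonneg _ (by positivity),
    ← ENNReal.mul_rpow_of_nonneg _ _ (by positivity : 0 ≤ 1 / p.toReal)]
  gcongr
  exact h

theorem hlMaximal_enorm_le {f g : 𝔼 → ℝ} (hg : AEStronglyMeasurable g volume) (x : 𝔼) :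
    hlMaximal volume (fun y => ‖f y‖ₑ) x ≤
      hlMaximal volume (fun y => ‖g y‖ₑ) x + hlMaximal volume (fun y => ‖f y - g y‖ₑ) x := by
  refine (hlMaximal_mono_ae (Eventually.of_forall fun y => ?_) x).trans
    (hlMaximal_add_le hg.enorm x)
  calc ‖f y‖ₑ = ‖g y + (f y - g y)‖ₑ := by rw [add_sub_cancel]
    _ ≤ ‖g y‖ₑ + ‖f y - g y‖ₑ := enorm_add_le _ _

/-- The maximal operator is sublinear. -/
theorem enorm_toReal_maximalFunction_sub_le {f g : 𝔼 → ℝ} (hf : AEStronglyMeasurable f volume)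
    (hg : AEStronglyMeasurable g volume) {x : 𝔼} (hfx : maximalFunction f x < ⊤)
    (hgx : maximalFunction g x < ⊤) :
    ‖(maximalFunction f x).toReal - (maximalFunction g x).toReal‖ₑ ≤
      hlMaximal volume (fun y => ‖f y - g y‖ₑ) x := by
  have h1 := hlMaximal_enorm_le (f := f) hg x
  have h2 := hlMaximal_enorm_le (f := g) hf x
  simp only [enorm_sub_rev (g _)] at h2
  rw [← maximalFunction_eq_hlMaximal, ← maximalFunction_eq_hlMaximal] at h1 h2
  set c := hlMaximal volume (fun y => ‖f y - g y‖ₑ) x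
  rcases eq_or_ne c ⊤ with hc | hc
  · rw [hc]
    exact le_top
  rw [← ofReal_norm, ENNReal.ofReal_le_iff_le_toReal hc, Real.norm_eq_abs, abs_le]
  have h3 := ENNReal.toReal_mono (ENNReal.add_ne_top.2 ⟨hgx.ne, hc⟩) h1
  have h4 := ENNReal.toReal_mono (ENNReal.add_ne_top.2 ⟨hfx.ne, hc⟩) h2
  rw [ENNReal.toReal_add hgx.ne hc] at h3
  rw [ENNReal.toReal_add hfx.ne hc] at h4
  constructor <;> linarith

theorem ae_maximalFunction_lt_top (hn : 1 ≤ n) (hp1 : p ≠ 1) (hp : p ≠ ⊤) {f : 𝔼 → ℝ}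
    (hf : MemLp f p volume) : ∀ᵐ x, maximalFunction f x < ⊤ := by
  have hp0 : p ≠ 0 := (zero_lt_one.trans_le Fact.out).ne'
  obtain ⟨C, hC⟩ := exists_eLpNorm_hlMaximal_le (n := n) hn hp1 hp
  have h1 : eLpNorm (maximalFunction f) p volume < ⊤ := by
    rw [maximalFunction_eq_hlMaximal]
    exact (hC f hf.1).trans_lt (ENNReal.mul_lt_top ENNReal.coe_lt_top hf.2)
  have h2 := lintegral_rpow_enorm_lt_top_of_eLpNorm_lt_top hp0 hp h1
  filter_upwards [ae_lt_top ((measurable_maximalFunction f).enorm.pow_const _) h2.ne] with x hx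
  rw [enorm_eq_self] at hx
  exact (ENNReal.rpow_lt_top_iff_of_pos (ENNReal.toReal_pos hp0 hp)).1 hx

theorem memLp_toReal_maximalFunction (hn : 1 ≤ n) (hp1 : p ≠ 1) (hp : p ≠ ⊤) {f : 𝔼 → ℝ}
    (hf : MemLp f p volume) : MemLp (fun x => (maximalFunction f x).toReal) p volume := by
  obtain ⟨C, hC⟩ := exists_eLpNorm_hlMaximal_le (n := n) hn hp1 hp
  refine ⟨(measurable_maximalFunction f).ennreal_toReal.aestronglyMeasurable, ?_⟩
  exact (eLpNorm_toReal_maximalFunction_le hC hf.1).trans_lt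
    (ENNReal.mul_lt_top ENNReal.coe_lt_top hf.2)

theorem eLpNorm_toReal_maximalFunction_sub_le {C : NNReal} (hn : 1 ≤ n) (hp1 : p ≠ 1) (hp : p ≠ ⊤)
    (hC : ∀ f : 𝔼 → ℝ, AEStronglyMeasurable f volume →
      eLpNorm (hlMaximal volume fun y => ‖f y‖ₑ) p volume ≤ C * eLpNorm f p volume)
    {f : 𝔼 → ℝ} (hf : MemLp f p volume) (y : 𝔼) :
    eLpNorm (fun x => (maximalFunction f (x + y)).toReal - (maximalFunction f x).toReal) p volume ≤
      C * eLpNorm (fun x => f (x + y) - f x) p volume := by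
  have hfy : MemLp (fun x => f (x + y)) p volume := memLp_comp_add_right hf y
  refine le_trans (eLpNorm_mono_enorm_ae ?_) (hC _ (hfy.sub hf).1)
  filter_upwards [ae_maximalFunction_lt_top hn hp1 hp hf,
    ae_maximalFunction_lt_top hn hp1 hp hfy] with x h1 h2
  have h3 : maximalFunction f (x + y) = maximalFunction (fun x => f (x + y)) x := by
    rw [maximalFunction_eq_hlMaximal, maximalFunction_eq_hlMaximal]
    exact (hlMaximal_comp_add_right (fun y => ‖f y‖ₑ) y x).symm
  rw [h3, enorm_eq_self]
  exact enorm_toReal_maximalFunction_sub_le hfy.1 hf.1 h2 h1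

/-- Kinnunen's theorem: the maximal function of a function in `W^{1,p}` is in `W^{1,p}`, and
`‖∂ᵢMu‖ ≤ C ‖∂ᵢu‖`. Translations commute with the maximal operator, so that the difference
quotients of `Mu` are bounded by the maximal functions of those of `u`. -/
theorem exists_hasWeakPartialDeriv_maximalFunction (hn : 1 ≤ n) (hp1 : p ≠ 1) (hp : p ≠ ⊤) :
    ∃ C : NNReal, ∀ (u : Lp ℝ p (volume : Measure 𝔼)) (g : Fin n → Lp ℝ p (volume : Measure 𝔼)),
      (∀ i, HasWeakPartialDeriv i u (g i)) → ∀ i, ∃ g' : Lp ℝ p (volume : Measure 𝔼),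
        ‖g'‖ ≤ C * ‖g i‖ ∧ HasWeakPartialDeriv i (fun x => (maximalFunction u x).toReal) g' := by
  obtain ⟨C, hC⟩ := exists_eLpNorm_hlMaximal_le (n := n) hn hp1 hp
  refine ⟨C, fun u g hg i => ?_⟩
  have hquot : ∀ t : ℝ, eLpNorm (fun x =>
      (maximalFunction u (x + t • EuclideanSpace.single i 1)).toReal -
        (maximalFunction u x).toReal) p volume ≤ ‖t‖ₑ * ((C * ‖g i‖₊ : NNReal) : ℝ≥0∞) := by
    intro t
    refine (eLpNorm_toReal_maximalFunction_sub_le hn hp1 hp hC (Lp.memLp u) _).trans ?_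
    have h1 := eLpNorm_translate_sub_le hp1 hp (Lp.memLp u) (fun i => Lp.memLp (g i)) hg
      (t • EuclideanSpace.single i 1)
    rw [Finset.sum_eq_single_of_mem i (Finset.mem_univ i) (fun j _ hj => by simp [hj])] at h1
    calc _ ≤ C * (‖t‖ₑ * eLpNorm (g i) p volume) := by
          gcongr
          simpa using h1
      _ = ‖t‖ₑ * ((C * ‖g i‖₊ : NNReal) : ℝ≥0∞) := by
          rw [← Lp.enorm_def, ENNReal.coe_mul, ← enorm_eq_nnnorm]
          ring
  obtain ⟨g', hg', hd⟩ := exists_hasWeakPartialDeriv_of_eLpNorm_translate_sub_le hp1 hp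
    (memLp_toReal_maximalFunction hn hp1 hp (Lp.memLp u)) i hquot
  exact ⟨g', by simpa using hg', hd⟩

/-- On a ball, the maximal function depends on the values outside a larger ball only up to a small
error, as the average of an `L^p` function over a large ball is small. -/
theorem hlMaximal_le_indicator_add (hp1 : p ≠ 1) (hp : p ≠ ⊤) {g : 𝔼 → ℝ≥0∞}
    (hg : AEMeasurable g volume) {K ρ : ℝ} {x : 𝔼} (hx : x ∈ Metric.ball (0 : 𝔼) K) :
    hlMaximal volume g x ≤
      hlMaximal volume ((Metric.ball (0 : 𝔼) (K + ρ)).indicator g) x +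
        (volume (Metric.ball (0 : 𝔼) ρ))⁻¹ ^ (1 / p.toReal) *
          (∫⁻ y, g y ^ p.toReal) ^ (1 / p.toReal) := by
  have hr : 1 < p.toReal := by
    rw [← ENNReal.toReal_one]
    exact (ENNReal.toReal_lt_toReal ENNReal.one_ne_top hp).2 (lt_of_le_of_ne Fact.out hp1.symm)
  have hr0 : 0 < p.toReal := by linarith
  have hc := Real.HolderConjugate.conjExponent hr
  set r := p.toReal
  set r' := Real.conjExponent r
  refine iSup₂_le fun R hR => ?_
  rcases le_total R ρ with h | h
  -- A ball of radius `R ≤ ρ` centred at `x` lies in the larger ball.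
  · refine le_add_right (le_trans ?_ (le_hlMaximal volume _ x hR))
    gcongr 1
    refine le_of_eq (setLIntegral_congr_fun measurableSet_ball fun y hy => ?_)
    refine (Set.indicator_of_mem ?_ _).symm
    have h1 := mem_ball_zero_iff.1 hx
    have h2 := Metric.mem_ball.1 hy
    rw [mem_ball_zero_iff]
    calc ‖y‖ = ‖x + (y - x)‖ := by rw [add_sub_cancel]
      _ ≤ ‖x‖ + ‖y - x‖ := norm_add_le _ _
      _ < K + ρ := by
        rw [← dist_eq_norm]
        linarith
  -- For `R ≥ ρ` the average is small by Hölder's inequality.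
  · refine le_add_left ?_
    set V := volume (Metric.ball x R) with hV
    have hV0 : V ≠ 0 := (Metric.measure_ball_pos volume x hR).ne'
    have hVtop : V ≠ ⊤ := measure_ball_lt_top.ne
    have h1 := ENNReal.lintegral_mul_le_Lp_mul_Lq (volume.restrict (Metric.ball x R)) hc
      hg.restrict (aemeasurable_const (b := (1 : ℝ≥0∞)))
    simp only [Pi.mul_apply, mul_one, ENNReal.one_rpow, lintegral_const,
      Measure.restrict_apply_univ, one_mul] at h1
    have h2 : V⁻¹ * V ^ (1 / r') = V⁻¹ ^ (1 / r) := by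
      have h3 : 1 / r = 1 - 1 / r' := by
        have := hc.inv_add_inv_eq_one
        rw [one_div, one_div]
        linarith
      rw [h3, ENNReal.inv_rpow, ENNReal.rpow_sub _ _ hV0 hVtop, ENNReal.rpow_one,
        ENNReal.inv_div (Or.inr hVtop) (Or.inr hV0), mul_comm, ← div_eq_mul_inv]
    calc V⁻¹ * ∫⁻ y in Metric.ball x R, g y
        ≤ V⁻¹ * ((∫⁻ y in Metric.ball x R, g y ^ r) ^ (1 / r) * V ^ (1 / r')) := by gcongr
      _ = V⁻¹ ^ (1 / r) * (∫⁻ y in Metric.ball x R, g y ^ r) ^ (1 / r) := by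
          rw [← h2]
          ring
      _ ≤ _ := by
          gcongr
          · rw [hV, Measure.addHaar_ball_center volume x R]
            exact measure_mono (Metric.ball_subset_ball h)
          · exact Measure.restrict_le_self

theorem tendsto_inv_measure_ball_rpow (hn : 1 ≤ n) {r : ℝ} (hr : 0 < r) :
    Tendsto (fun ρ : ℝ => (volume (Metric.ball (0 : 𝔼) ρ))⁻¹ ^ r) atTop (𝓝 0) := by
  have : Nonempty (Fin n) := ⟨⟨0, hn⟩⟩
  have h1 : Tendsto (fun ρ : ℝ => volume (Metric.ball (0 : 𝔼) ρ)) atTop (𝓝 ⊤) := by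
    have h2 : Tendsto (fun ρ : ℝ => ENNReal.ofReal ρ * volume (Metric.ball (0 : 𝔼) 1)) atTop
        (𝓝 ⊤) := by
      have h3 := ENNReal.Tendsto.mul_const ENNReal.tendsto_ofReal_atTop
        (b := volume (Metric.ball (0 : 𝔼) 1)) (Or.inl ENNReal.top_ne_zero)
      rwa [ENNReal.top_mul (Metric.measure_ball_pos volume _ one_pos).ne'] at h3
    refine tendsto_nhds_top_mono h2 ?_
    filter_upwards [eventually_ge_atTop 1] with ρ hρ
    rw [Measure.addHaar_ball_of_pos volume _ (zero_lt_one.trans_le hρ)]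
    refine mul_le_mul_left (ENNReal.ofReal_le_ofReal (le_self_pow₀ hρ ?_)) _
    rw [finrank_euclideanSpace_fin]
    omega
  have h4 := (ENNReal.continuous_rpow_const (y := r)).tendsto _ |>.comp
    ((continuous_inv.tendsto (⊤ : ℝ≥0∞)).comp h1)
  simpa [Function.comp_def, ENNReal.zero_rpow_of_pos hr] using! h4

/-- If `uₖ → u` in `L^p` on sets of finite measure and `uₖ` is bounded in `L^p`, then `Muₖ → Mu` in
`L^p` on balls. -/
theorem tendsto_eLpNorm_maximalFunction_sub (hn : 1 ≤ n) (hp1 : p ≠ 1) (hp : p ≠ ⊤)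
    {u : ℕ → Lp ℝ p (volume : Measure 𝔼)} {u₀ : Lp ℝ p (volume : Measure 𝔼)} {B : NNReal}
    (hB : ∀ k, ‖u k - u₀‖ₑ ≤ B) (hloc : ∀ S : Set 𝔼, volume S ≠ ⊤ →
      Tendsto (fun k => eLpNorm (⇑(u k - u₀)) p (volume.restrict S))
        atTop (𝓝 0)) (K : ℝ) :
    Tendsto (fun k => eLpNorm (fun x => (maximalFunction (u k) x).toReal -
      (maximalFunction u₀ x).toReal) p (volume.restrict (Metric.ball 0 K))) atTop (𝓝 0) := by
  have hp1' : 1 ≤ p := Fact.out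
  have hp0 : p ≠ 0 := (zero_lt_one.trans_le hp1').ne'
  have hr0 : 0 < p.toReal := ENNReal.toReal_pos hp0 hp
  obtain ⟨C, hC⟩ := exists_eLpNorm_hlMaximal_le (n := n) hn hp1 hp
  set V : ℝ≥0∞ := volume (Metric.ball (0 : 𝔼) K) ^ (1 / p.toReal) with hV
  have hVtop : V ≠ ⊤ := ENNReal.rpow_ne_top_of_nonneg (by positivity) measure_ball_lt_top.ne
  set D : ℝ → ℝ≥0∞ := fun ρ => (volume (Metric.ball (0 : 𝔼) ρ))⁻¹ ^ (1 / p.toReal) with hD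
  have hest : ∀ k (ρ : ℝ),
      eLpNorm (fun x => (maximalFunction (u k) x).toReal - (maximalFunction u₀ x).toReal) p
        (volume.restrict (Metric.ball 0 K)) ≤
      C * eLpNorm (⇑(u k - u₀)) p
        (volume.restrict (Metric.ball 0 (K + ρ))) + D ρ * B * V := by
    intro k ρ
    set f : 𝔼 → ℝ := ⇑(u k - u₀) with hf
    have hfm : AEStronglyMeasurable f volume := (Lp.memLp _).1
    set F : 𝔼 → ℝ := (Metric.ball (0 : 𝔼) (K + ρ)).indicator f with hF
    have hFm : AEStronglyMeasurable F volume := hfm.indicator measurableSet_ball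
    have hpt : ∀ᵐ x ∂(volume.restrict (Metric.ball (0 : 𝔼) K)),
        ‖(maximalFunction (u k) x).toReal - (maximalFunction u₀ x).toReal‖ₑ ≤
          ‖hlMaximal volume (fun y => ‖F y‖ₑ) x + D ρ * B‖ₑ := by
      filter_upwards [ae_restrict_of_ae (ae_maximalFunction_lt_top hn hp1 hp (Lp.memLp (u k))),
        ae_restrict_of_ae (ae_maximalFunction_lt_top hn hp1 hp (Lp.memLp u₀)),
        ae_restrict_mem measurableSet_ball] with x h1 h2 hx
      have h3 : (fun y => ‖u k y - u₀ y‖ₑ) =ᵐ[volume] fun y => ‖f y‖ₑ :=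
        (Lp.coeFn_sub (u k) u₀).mono fun y hy => by simp only [hf, hy, Pi.sub_apply]
      have h4 : (Metric.ball (0 : 𝔼) (K + ρ)).indicator (fun y => ‖f y‖ₑ) = fun y => ‖F y‖ₑ := by
        ext y
        by_cases hy : y ∈ Metric.ball (0 : 𝔼) (K + ρ) <;> simp [hF, hy]
      have h5 := hlMaximal_le_indicator_add hp1 hp hfm.enorm (ρ := ρ) hx
      rw [h4, ← eLpNorm_eq_lintegral_rpow_enorm_toReal hp0 hp, hf, ← Lp.enorm_def] at h5
      rw [enorm_eq_self]
      refine (enorm_toReal_maximalFunction_sub_le (Lp.memLp (u k)).1 (Lp.memLp u₀).1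
        h1 h2).trans ?_
      rw [hlMaximal_congr_ae h3]
      refine h5.trans ?_
      gcongr
      exact hB k
    refine (eLpNorm_mono_enorm_ae hpt).trans ?_
    refine (eLpNorm_add_le (measurable_hlMaximal _).aestronglyMeasurable
      aestronglyMeasurable_const hp1').trans ?_
    gcongr
    · refine (eLpNorm_mono_measure _ Measure.restrict_le_self).trans ((hC F hFm).trans ?_)
      rw [hF, eLpNorm_indicator_eq_eLpNorm_restrict measurableSet_ball]
    · rw [eLpNorm_const' _ hp0 hp, enorm_eq_self, Measure.restrict_apply_univ]
  rw [ENNReal.tendsto_nhds_zero]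
  intro δ hδ
  have hδ2 : 0 < δ / 2 := ENNReal.half_pos hδ.ne'
  obtain ⟨ρ, hρ⟩ : ∃ ρ : ℝ, D ρ * B * V ≤ δ / 2 := by
    have h1 : Tendsto (fun ρ => D ρ * B * V) atTop (𝓝 0) := by
      have h2 := ENNReal.Tendsto.mul_const (ENNReal.Tendsto.mul_const
        (tendsto_inv_measure_ball_rpow (n := n) hn (one_div_pos.2 hr0))
        (Or.inr (ENNReal.coe_ne_top (r := B)))) (Or.inr hVtop)
      simpa only [zero_mul] using h2
    exact (h1.eventually (ge_mem_nhds hδ2)).exists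
  have h3 := ENNReal.Tendsto.const_mul (a := (C : ℝ≥0∞))
    (hloc (Metric.ball 0 (K + ρ)) measure_ball_lt_top.ne) (Or.inr ENNReal.coe_ne_top)
  rw [mul_zero] at h3
  filter_upwards [h3.eventually (ge_mem_nhds hδ2)] with k hk
  calc _ ≤ _ := hest k ρ
    _ ≤ δ / 2 + δ / 2 := add_le_add hk hρ
    _ = δ := ENNReal.add_halves δ

end MaximalFunction

/-! ### Weak convergence in `L^p` and in `W^{1,p}` -/

section WeakConvergence

theorem tendsto_toWeakSpace_iff {X : Type*} [NormedAddCommGroup X] [NormedSpace ℝ X] {u : ℕ → X}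
    {u₀ : X} : Tendsto (fun k => toWeakSpace ℝ X (u k)) atTop (𝓝 (toWeakSpace ℝ X u₀)) ↔
      ∀ ℓ : StrongDual ℝ X, Tendsto (fun k => ℓ (u k)) atTop (𝓝 (ℓ u₀)) := by
  have hinj : Function.Injective (topDualPairing ℝ X).flip := fun x y hxy =>
    SeparatingDual.eq_iff_forall_dual_eq.2 fun ℓ => LinearMap.congr_fun hxy ℓ
  exact WeakBilin.tendsto_iff_forall_eval_tendsto _ hinj

/-- A weakly convergent sequence is bounded. -/
theorem exists_norm_le_of_weak {X : Type*} [NormedAddCommGroup X] [NormedSpace ℝ X] {u : ℕ → X}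
    {u₀ : X} (h : ∀ ℓ : StrongDual ℝ X, Tendsto (fun k => ℓ (u k)) atTop (𝓝 (ℓ u₀))) :
    ∃ B : ℝ, ∀ k, ‖u k‖ ≤ B := by
  obtain ⟨C, hC⟩ := banach_steinhaus (g := fun k => NormedSpace.inclusionInDoubleDualLi ℝ (u k))
    fun ℓ => by
      obtain ⟨C, hC⟩ := (h ℓ).norm.bddAbove_range
      exact ⟨C, fun k => hC ⟨k, rfl⟩⟩
  refine ⟨C, fun k => ?_⟩
  rw [← (NormedSpace.inclusionInDoubleDualLi ℝ).norm_map (u k)]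
  exact hC k

variable {n : ℕ} {p : ℝ≥0∞}

local notation "𝔼" => EuclideanSpace ℝ (Fin n)

/-- Weak convergence in `A × B^n`, with an `ℓ^p` norm, is weak convergence of the components. -/
theorem tendsto_dual_prod_piLp {A B : Type*} [NormedAddCommGroup A] [NormedSpace ℝ A]
    [NormedAddCommGroup B] [NormedSpace ℝ B] {x : ℕ → WithLp p (A × PiLp p fun _ : Fin n => B)}
    {x₀ : WithLp p (A × PiLp p fun _ : Fin n => B)}
    (h : ∀ ℓ : StrongDual ℝ A, Tendsto (fun k => ℓ (x k).fst) atTop (𝓝 (ℓ x₀.fst)))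
    (hd : ∀ i, ∀ ℓ : StrongDual ℝ B,
      Tendsto (fun k => ℓ ((x k).snd i)) atTop (𝓝 (ℓ (x₀.snd i))))
    (L : StrongDual ℝ (WithLp p (A × PiLp p fun _ : Fin n => B))) :
    Tendsto (fun k => L (x k)) atTop (𝓝 (L x₀)) := by
  set e := WithLp.prodContinuousLinearEquiv p ℝ A (PiLp p fun _ : Fin n => B)
  set e' := PiLp.continuousLinearEquiv p ℝ fun _ : Fin n => B
  set L₀ : StrongDual ℝ A :=
    (L.comp e.symm.toContinuousLinearMap).comp (ContinuousLinearMap.inl ℝ _ _)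
  set L' : StrongDual ℝ (Fin n → B) := ((L.comp e.symm.toContinuousLinearMap).comp
    (ContinuousLinearMap.inr ℝ _ _)).comp e'.symm.toContinuousLinearMap
  have hsum : ∀ x, L x = L₀ x.fst +
      ∑ i, (L'.comp (ContinuousLinearMap.single ℝ (fun _ : Fin n => B) i)) (x.snd i) := by
    intro x
    have h1 : ∑ i, (L'.comp (ContinuousLinearMap.single ℝ (fun _ : Fin n => B) i)) (x.snd i) =
        L' fun i => x.snd i := by
      simp only [ContinuousLinearMap.comp_apply]
      rw [← map_sum]
      congr 1
      exact Finset.univ_sum_single fun i => x.snd i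
    have h2 : x = e.symm (x.fst, 0) + e.symm (0, e'.symm fun i => x.snd i) := by
      rw [← map_add, ContinuousLinearEquiv.eq_symm_apply, Prod.mk_add_mk, add_zero, zero_add]
      rfl
    rw [h1]
    conv_lhs => rw [h2, map_add]
    rfl
  simp only [hsum]
  exact (h L₀).add (tendsto_finsetSum _ fun i _ => hd i _)

variable [Fact (1 ≤ p)]

/-- A bounded sequence in `L^p`, `1 < p < ∞`, that converges when tested on test functions
converges weakly. -/
theorem tendsto_dual_of_forall_test (hp1 : p ≠ 1) (hp : p ≠ ⊤)
    {f : ℕ → Lp ℝ p (volume : Measure 𝔼)} {f₀ : Lp ℝ p (volume : Measure 𝔼)} {B : NNReal}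
    (hB : ∀ k, ‖f k - f₀‖ₑ ≤ B)
    (h : ∀ φ : 𝔼 → ℝ, ContDiff ℝ ∞ φ → HasCompactSupport φ →
      Tendsto (fun k => ∫ x, f k x * φ x) atTop (𝓝 (∫ x, f₀ x * φ x)))
    (ℓ : StrongDual ℝ (Lp ℝ p (volume : Measure 𝔼))) :
    Tendsto (fun k => ℓ (f k)) atTop (𝓝 (ℓ f₀)) := by
  obtain ⟨q, hpq⟩ : ∃ q, p.HolderConjugate q := ⟨_, .conjExponent Fact.out⟩
  have : Fact (1 ≤ q) := ⟨ENNReal.HolderConjugate.one_le q p⟩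
  have hq : q ≠ ⊤ := (ENNReal.HolderConjugate.ne_top_iff_ne_one q p).2 hp1
  obtain ⟨g, -, hℓ⟩ := exists_eq_lpPairing (q := q) hp1 hp ℓ
  set T := (ContinuousLinearMap.mul ℝ ℝ).lpPairing (volume : Measure 𝔼) p q with hT
  have hTi : ∀ f g, T f g = ∫ x, f x * g x := fun f g =>
    ContinuousLinearMap.lpPairing_eq_integral _ f g
  simp only [hℓ, ← hTi]
  rw [tendsto_iff_norm_sub_tendsto_zero, Metric.tendsto_atTop]
  intro ε hε
  -- The summand `1` keeps the denominator positive if `T` or `B` vanishes.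
  set δ : ℝ := ε / (2 * (‖T‖ * B + 1)) with hδ
  have hδ0 : 0 < δ := by positivity
  obtain ⟨g', hg', hgg'⟩ := Metric.dense_iff.1
    (Lp.dense_hasCompactSupport_contDiff (F := ℝ) (μ := (volume : Measure 𝔼)) hq) g δ hδ0
  obtain ⟨φ, hφ, hc, hφs⟩ := hgg'
  have hφi : ∀ f : Lp ℝ p (volume : Measure 𝔼), T f g' = ∫ x, f x * φ x := by
    intro f
    rw [hTi]
    exact integral_congr_ae (hφ.mono fun x hx => by simp only [hx])
  have h1 := h φ hφs hc
  simp only [← hφi] at h1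
  rw [tendsto_iff_norm_sub_tendsto_zero] at h1
  obtain ⟨N, hN⟩ := Metric.tendsto_atTop.1 h1 (ε / 2) (half_pos hε)
  refine ⟨N, fun k hk => ?_⟩
  have h2 := hN k hk
  rw [dist_zero_right, norm_norm] at h2 ⊢
  have h3 : ‖T (f k - f₀) (g - g')‖ ≤ ε / 2 := by
    calc ‖T (f k - f₀) (g - g')‖ ≤ ‖T‖ * ‖f k - f₀‖ * ‖g - g'‖ := T.le_opNorm₂ _ _
      _ ≤ ‖T‖ * B * δ := by
        gcongr
        · rw [← toReal_enorm]
          exact ENNReal.toReal_mono ENNReal.coe_ne_top (hB k)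
        · rw [← dist_eq_norm, dist_comm]
          exact (Metric.mem_ball.1 hg').le
      _ ≤ (‖T‖ * B + 1) * δ := by gcongr; linarith
      _ = ε / 2 := by
        rw [hδ]
        field_simp
  have h4 : T (f k) g - T f₀ g = T (f k - f₀) (g - g') + (T (f k) g' - T f₀ g') := by
    simp only [map_sub, sub_apply]
    ring
  rw [h4]
  linarith [norm_add_le (T (f k - f₀) (g - g')) (T (f k) g' - T f₀ g')]

namespace SobolevW1p

/-- The weak partial derivative `∂ᵢ` as a continuous linear map `W^{1,p} → L^p`. -/
noncomputable def partialL (i : Fin n) : SobolevW1p n p →L[ℝ] Lp ℝ p (volume : Measure 𝔼) :=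
  (PiLp.proj p (fun _ : Fin n => Lp ℝ p (volume : Measure 𝔼)) i).comp
    ((WithLp.sndL p ℝ _ _).comp (SobolevW1p n p).subtypeL)

/-- The inclusion of `W^{1,p}` in `L^p` as a continuous linear map. -/
noncomputable def toLpL : SobolevW1p n p →L[ℝ] Lp ℝ p (volume : Measure 𝔼) :=
  (WithLp.fstL p ℝ _ (PiLp p fun _ : Fin n => Lp ℝ p (volume : Measure 𝔼))).comp
    (SobolevW1p n p).subtypeL

theorem hasWeakPartialDeriv (w : SobolevW1p n p) (i : Fin n) :
    HasWeakPartialDeriv i (toLpL w) (partialL i w) :=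
  w.2 i

/-- Weak convergence in `W^{1,p}` follows from the weak convergence in `L^p` of the functions and
of their partial derivatives, as functionals on `W^{1,p}` extend to `L^p × (L^p)^n`. -/
theorem tendsto_dual {w : ℕ → SobolevW1p n p} {w₀ : SobolevW1p n p}
    (h : ∀ ℓ : StrongDual ℝ (Lp ℝ p (volume : Measure 𝔼)),
      Tendsto (fun k => ℓ (toLpL (w k))) atTop (𝓝 (ℓ (toLpL w₀))))
    (hd : ∀ i, ∀ ℓ : StrongDual ℝ (Lp ℝ p (volume : Measure 𝔼)),
      Tendsto (fun k => ℓ (partialL i (w k))) atTop (𝓝 (ℓ (partialL i w₀))))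
    (ℓ : StrongDual ℝ (SobolevW1p n p)) : Tendsto (fun k => ℓ (w k)) atTop (𝓝 (ℓ w₀)) := by
  obtain ⟨L, hL, -⟩ := exists_extension_norm_eq (SobolevW1p n p) ℓ
  simp only [← hL]
  exact tendsto_dual_prod_piLp h hd L

end SobolevW1p

/-- Convergence in `L^p` on balls gives the convergence of integrals against test functions. -/
theorem tendsto_integral_mul_of_eLpNorm_ball {v : ℕ → 𝔼 → ℝ} {v₀ : 𝔼 → ℝ}
    (hv : ∀ k, MemLp (v k) p volume) (hv₀ : MemLp v₀ p volume)
    (h : ∀ K : ℝ, Tendsto (fun k => eLpNorm (fun x => v k x - v₀ x) p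
      (volume.restrict (Metric.ball 0 K))) atTop (𝓝 0))
    {φ : 𝔼 → ℝ} (hφ : Continuous φ) (hc : HasCompactSupport φ) :
    Tendsto (fun k => ∫ x, v k x * φ x) atTop (𝓝 (∫ x, v₀ x * φ x)) := by
  have hp1 : 1 ≤ p := Fact.out
  obtain ⟨q, hpq⟩ : ∃ q, p.HolderConjugate q := ⟨_, .conjExponent hp1⟩
  have hφq : MemLp φ q volume := hφ.memLp_of_hasCompactSupport hc
  obtain ⟨K, hK⟩ := hc.isCompact.isBounded.subset_ball 0
  have hle : ∀ k, ‖(∫ x, v k x * φ x) - ∫ x, v₀ x * φ x‖ₑ ≤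
      eLpNorm (fun x => v k x - v₀ x) p (volume.restrict (Metric.ball 0 K)) *
        eLpNorm φ q volume := by
    intro k
    rw [← integral_sub (integrable_mul_test ((hv k).locallyIntegrable hp1) hφ hc)
      (integrable_mul_test (hv₀.locallyIntegrable hp1) hφ hc)]
    have h1 : ∫ x, (v k x * φ x - v₀ x * φ x) =
        ∫ x in Metric.ball (0 : 𝔼) K, (v k x - v₀ x) * φ x := by
      rw [setIntegral_eq_integral_of_forall_compl_eq_zero fun x hx => by
        rw [image_eq_zero_of_notMem_tsupport fun hx' => hx (hK hx'), mul_zero]]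
      simp only [sub_mul]
    rw [h1]
    refine (enorm_integral_mul_le (p := p) (q := q) ((hv k).sub hv₀).1.restrict
      hφq.1.restrict).trans ?_
    gcongr
    · exact le_rfl
    · exact Measure.restrict_le_self
  rw [tendsto_iff_enorm_sub_tendsto_zero]
  have h2 := ENNReal.Tendsto.mul_const (h K) (Or.inr hφq.eLpNorm_ne_top)
  rw [zero_mul] at h2
  exact tendsto_of_tendsto_of_tendsto_of_le_of_le tendsto_const_nhds h2 (fun _ => zero_le) hle

/-- The sequential weak continuity of the maximal operator on a normed space `X` of Sobolev
functions: `T x` is the function underlying `x`, and `D i x` is its `i`-th partial derivative. If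
`uₖ ⇀ u` weakly, then `Muₖ → Mu` in `L^p` on balls, hence as distributions together with the
derivatives, and `Muₖ` is bounded. -/
theorem seqWeaklyContinuous_of_eq_maximalFunction (hn : 1 ≤ n) (hp1 : p ≠ 1) (hp : p ≠ ⊤)
    {X : Type*} [NormedAddCommGroup X] [NormedSpace ℝ X]
    (T : X →L[ℝ] Lp ℝ p (volume : Measure 𝔼)) (D : Fin n → X →L[ℝ] Lp ℝ p (volume : Measure 𝔼))
    (hTD : ∀ x i, HasWeakPartialDeriv i (T x) (D i x))
    (hdual : ∀ (x : ℕ → X) (x₀ : X),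
      (∀ ℓ : StrongDual ℝ (Lp ℝ p (volume : Measure 𝔼)),
        Tendsto (fun k => ℓ (T (x k))) atTop (𝓝 (ℓ (T x₀)))) →
      (∀ i, ∀ ℓ : StrongDual ℝ (Lp ℝ p (volume : Measure 𝔼)),
        Tendsto (fun k => ℓ (D i (x k))) atTop (𝓝 (ℓ (D i x₀)))) →
      ∀ ℓ : StrongDual ℝ X, Tendsto (fun k => ℓ (x k)) atTop (𝓝 (ℓ x₀)))
    {M : X → X} (hM : ∀ x, T (M x) =ᵐ[volume] fun y => (maximalFunction (T x) y).toReal) :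
    SeqWeaklyContinuous M := by
  intro u u₀ hu
  rw [tendsto_toWeakSpace_iff] at hu ⊢
  obtain ⟨C₁, hC₁⟩ := exists_eLpNorm_hlMaximal_le (n := n) hn hp1 hp
  obtain ⟨C₂, hC₂⟩ := exists_hasWeakPartialDeriv_maximalFunction (n := n) hn hp1 hp
  have hMT : ∀ x, ‖T (M x)‖ ≤ C₁ * ‖T x‖ := by
    intro x
    have h1 : ‖T (M x)‖ₑ ≤ C₁ * ‖T x‖ₑ := by
      rw [Lp.enorm_def, Lp.enorm_def, eLpNorm_congr_ae (hM x)]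
      exact eLpNorm_toReal_maximalFunction_le hC₁ (Lp.memLp _).1
    have h2 := ENNReal.toReal_mono (ENNReal.mul_ne_top ENNReal.coe_ne_top enorm_ne_top) h1
    rwa [ENNReal.toReal_mul, toReal_enorm, toReal_enorm, ENNReal.coe_toReal] at h2
  have hMD : ∀ x i, ‖D i (M x)‖ ≤ C₂ * ‖D i x‖ := by
    intro x i
    obtain ⟨g, hg, hd⟩ := hC₂ (T x) (fun i => D i x) (hTD x) i
    have h1 : D i (M x) = g :=
      Lp.ext (((hTD (M x) i).congr (hM x) (ae_eq_refl _)).ae_unique hd)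
    rwa [h1]
  -- All the sequences involved are bounded.
  have hbdd : ∀ S : X →L[ℝ] Lp ℝ p (volume : Measure 𝔼), ∃ B : ℝ, ∀ k, ‖S (u k)‖ ≤ B := fun S =>
    exists_norm_le_of_weak (u₀ := S u₀) fun ℓ => hu (ℓ.comp S)
  obtain ⟨B₀, hB₀⟩ := hbdd T
  choose B₁ hB₁ using fun i => hbdd (D i)
  have henorm : ∀ {a b : Lp ℝ p (volume : Measure 𝔼)} {c : ℝ}, ‖a‖ ≤ c →
      ‖a - b‖ₑ ≤ ((c + ‖b‖).toNNReal : ℝ≥0∞) := by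
    intro a b c h
    rw [← ofReal_norm]
    exact ENNReal.ofReal_le_ofReal ((norm_sub_le a b).trans (by gcongr))
  set B : NNReal := (B₀ + ‖T u₀‖).toNNReal + ∑ i, (B₁ i + ‖D i u₀‖).toNNReal with hBdef
  have hTB : ∀ k, ‖T (u k) - T u₀‖ₑ ≤ B := fun k =>
    (henorm (hB₀ k)).trans (ENNReal.coe_le_coe.2 le_self_add)
  have hDB : ∀ k i, ‖D i (u k) - D i u₀‖ₑ ≤ B := fun k i =>
    (henorm (hB₁ i k)).trans (ENNReal.coe_le_coe.2 (le_add_left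
      (Finset.single_le_sum (f := fun i => (B₁ i + ‖D i u₀‖).toNNReal) (fun _ _ => zero_le)
        (Finset.mem_univ i))))
  have hlim : ∀ K : ℝ, Tendsto (fun k => eLpNorm (fun x => T (M (u k)) x - T (M u₀) x) p
      (volume.restrict (Metric.ball 0 K))) atTop (𝓝 0) := by
    intro K
    refine (tendsto_eLpNorm_maximalFunction_sub hn hp1 hp hTB (fun S hS => ?_) K).congr fun k =>
      eLpNorm_congr_ae ?_
    · refine tendsto_eLpNorm_restrict_of_weak hp1 hp (h := fun k => T (u k) - T u₀)
        (g := fun k i => D i (u k) - D i u₀) (fun k i => ?_) hTB hDB (fun ℓ => ?_) hS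
      · rw [← map_sub, ← map_sub]
        exact hTD _ i
      · have h1 := (hu (ℓ.comp T)).sub_const (ℓ (T u₀))
        simpa only [map_sub, ContinuousLinearMap.comp_apply, sub_self] using h1
    · filter_upwards [ae_restrict_of_ae (hM (u k)), ae_restrict_of_ae (hM u₀)] with x h1 h2
      rw [h1, h2]
  have htest : ∀ φ : 𝔼 → ℝ, Continuous φ → HasCompactSupport φ →
      Tendsto (fun k => ∫ x, T (M (u k)) x * φ x) atTop (𝓝 (∫ x, T (M u₀) x * φ x)) :=
    fun φ hφ hc =>
      tendsto_integral_mul_of_eLpNorm_ball (fun k => Lp.memLp _) (Lp.memLp _) hlim hφ hc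
  refine hdual (fun k => M (u k)) (M u₀) (fun ℓ => ?_) fun i ℓ => ?_
  · refine tendsto_dual_of_forall_test hp1 hp (fun k => henorm ((hMT (u k)).trans
      (mul_le_mul_of_nonneg_left (hB₀ k) C₁.2))) (fun φ hφ hc => htest φ hφ.continuous hc) ℓ
  · refine tendsto_dual_of_forall_test hp1 hp (fun k => henorm ((hMD (u k) i).trans
      (mul_le_mul_of_nonneg_left (hB₁ i k) C₂.2))) (fun φ hφ hc => ?_) ℓ
    have h1 : ∀ x, ∫ y, D i x y * φ y =
        -∫ y, T x y * fderiv ℝ φ y (EuclideanSpace.single i 1) := fun x => by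
      rw [(hTD x i).2.2 φ hφ hc, neg_neg]
    simp only [h1]
    exact (htest _ ((hφ.continuous_fderiv (by simp)).clm_apply continuous_const)
      (hc.fderiv_apply (𝕜 := ℝ) _)).neg

end WeakConvergence

/-- For `1 < p < ∞`, the Hardy-Littlewood maximal operator is a well-defined map
`M : W^{1,p}(ℝⁿ) → W^{1,p}(ℝⁿ)`, and it is sequentially weakly continuous. -/
theorem mainTheorem3 (n : ℕ) (hn : 1 ≤ n) (p : ℝ≥0∞) [Fact (1 ≤ p)] (hp : 1 < p) (hp' : p < ⊤) :
    ∃ M : SobolevW1p n p → SobolevW1p n p,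
      (∀ u : SobolevW1p n p, ∀ᵐ x ∂(volume : Measure (EuclideanSpace ℝ (Fin n))),
        maximalFunction (SobolevW1p.toLp u) x < ⊤ ∧ SobolevW1p.toLp (M u) x = (maximalFunction (SobolevW1p.toLp u) x).toReal) ∧
      SeqWeaklyContinuous M := by
  obtain ⟨C, hC⟩ := exists_hasWeakPartialDeriv_maximalFunction (n := n) hn hp.ne' hp'.ne
  have hex : ∀ u : SobolevW1p n p, ∃ w : SobolevW1p n p, SobolevW1p.toLp w =ᵐ[volume]
      fun x => (maximalFunction (SobolevW1p.toLp u) x).toReal := by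
    intro u
    have hmem := memLp_toReal_maximalFunction hn hp.ne' hp'.ne (Lp.memLp (SobolevW1p.toLp u))
    obtain ⟨w, hw⟩ := (SobolevW1p.exists_toLp_eq_iff hmem.toLp).2 fun i => by
      obtain ⟨g, -, hg⟩ := hC (SobolevW1p.toLp u) (fun i => SobolevW1p.partialL i u)
        (fun i => SobolevW1p.hasWeakPartialDeriv u i) i
      exact ⟨g, Lp.memLp g, hg.congr hmem.coeFn_toLp.symm (ae_eq_refl _)⟩
    exact ⟨w, hw ▸ hmem.coeFn_toLp⟩
  choose M hM using hex
  refine ⟨M, fun u => ?_, seqWeaklyContinuous_of_eq_maximalFunction hn hp.ne' hp'.ne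
    SobolevW1p.toLpL SobolevW1p.partialL SobolevW1p.hasWeakPartialDeriv
    (fun _ _ h hd => SobolevW1p.tendsto_dual h hd) hM⟩
  filter_upwards [hM u, ae_maximalFunction_lt_top hn hp.ne' hp'.ne
    (Lp.memLp (SobolevW1p.toLp u))] with x h1 h2
  exact ⟨h2, h1⟩
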